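/- Let $p$ be a prime and let $E/\mathbb{Q}_p$ be an elliptic curve with additive reduction that is given by a minimal Weierstrass equation $$y^2 + a_1xy + a_3y = x^3 + a_2x^2 + a_4x + a_6$$ over $\mathbb{Z}_p$ with $a_i \in p\mathbb{Z}_p$ for every $i\in\{1,2,3,4,6\}$. Let $E_0(\mathbb{Q}_p) \subset E(\mathbb{Q}_p)$ be the set of points whose reduction modulo $p$ is a nonsingular point of the reduced curve; it is a subgroup, and it carries the subspace topology from $E(\mathbb{Q}_p)\subset\mathbb{P}^2(\mathbb{Q}_p)$. Then $E_0(\mathbb{Q}_p)$ is topologically isomorphic (isomorphic as a topological group) to $\mathbb{Z}_p$, except in the following four cases: (i) $p=2$ and $a_1+a_3\equiv 2 \pmod 4$; (ii) $p=3$ and $a_2\equiv 6 \pmod 9$; (iii) $p=5$ and $a_4\equiv 10 \pmod{25}$; (iv) $p=7$ and $a_6\equiv 14 \pmod{49}$. In each of the cases (i)-(iv), $E_0(\mathbb{Q}_p)$ is topologically isomorphic to $p\mathbb{Z}_p\times\mathbb{F}_p$, where $\mathbb{F}_p$ denotes the additive group of the field with $p$ elements, with the discrete topology. -/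

import Mathlib

/-- The topology on the points of a projective Weierstrass curve over a topological field `K`: the
subspace topology from the projective plane over `K`, which carries the quotient topology
from the space of nonzero vectors of `K ^ 3`. -/
instance WeierstrassCurve.Projective.Point.instTopologicalSpace {K : Type*} [Field K]
    [TopologicalSpace K] (V : WeierstrassCurve.Projective K) : TopologicalSpace V.Point :=
  TopologicalSpace.induced (fun P : V.Point => P.point)
    (TopologicalSpace.coinduced
      (fun v : {v : Fin 3 → K // v ≠ 0} =>
        (Quotient.mk _ v.1 : WeierstrassCurve.Projective.PointClass K))
      inferInstance)

namespace AdditiveReduction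

variable {p : ℕ} [Fact p.Prime]

/-- The special fibre: the curve over the residue field obtained by reducing the coefficients of a
Weierstrass equation over `ℤ_[p]`. -/
noncomputable def specialFibre (W : WeierstrassCurve ℤ_[p]) :
    WeierstrassCurve (IsLocalRing.ResidueField ℤ_[p]) :=
  W.map (IsLocalRing.residue ℤ_[p])

/-- The `ℚ_[p]`-rational points of the projective plane curve defined by a Weierstrass equation
over `ℤ_[p]`, with the chord-tangent group law (when the generic fibre is an elliptic curve). -/
abbrev RationalPoint (W : WeierstrassCurve ℤ_[p]) : Type :=
  (W.baseChange ℚ_[p]).toProjective.Point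

/-- The set `E₀(ℚ_p)`: a rational point has nonsingular reduction if it has primitive homogeneous
coordinates `Q` in `ℤ_[p]` whose reduction is a nonsingular point of the special fibre. -/
def nonsingularReduction (W : WeierstrassCurve ℤ_[p]) : Set (RationalPoint W) :=
  {P | ∃ Q : Fin 3 → ℤ_[p], (∃ i, IsUnit (Q i)) ∧
    P.point = Quotient.mk _ (fun i => (Q i : ℚ_[p])) ∧
    (specialFibre W).toProjective.Nonsingular (fun i => IsLocalRing.residue ℤ_[p] (Q i))}

/-- The four exceptional cases. -/
def IsExceptional (W : WeierstrassCurve ℤ_[p]) : Prop :=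
  (p = 2 ∧ (4 : ℤ_[p]) ∣ W.a₁ + W.a₃ - 2) ∨
  (p = 3 ∧ (9 : ℤ_[p]) ∣ W.a₂ - 6) ∨
  (p = 5 ∧ (25 : ℤ_[p]) ∣ W.a₄ - 10) ∨
  (p = 7 ∧ (49 : ℤ_[p]) ∣ W.a₆ - 14)

end AdditiveReduction

/-! Modulo `p` the curve is the cuspidal cubic Y²Z = X³, singular only at [0:0:1], so E₀ consists of
the points [t : 1 : s] with t, s in `ℤ_[p]`. By Hensel's lemma every t determines a unique s, so t =
X/Y is a homeomorphism from E₀ to `ℤ_[p]` (`coordHomeomorph`). The chord construction has unit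
denominators there, and if d divides x and y then the sum of the points x and y has coordinate x + y
up to a multiple of p d² (`mul_sq_dvd_sum_sub`).

This estimate alone (`IsAdditiveCoordinate`) makes log P = lim t(p^k P)/p^k a continuous
homomorphism to `ℤ_[p]`, mapping the points with p ∣ t isomorphically onto pℤ_p. As t mod p is a
homomorphism onto 𝔽_p, E₀ is an extension of 𝔽_p by pℤ_p. Let g have t(g) = 1. If log g is a unit,
log is an isomorphism onto ℤ_p; otherwise (log, t mod p) is one onto pℤ_p × 𝔽_p. The second case
means p² ∣ t(p g) (`dvd_log_iff`).

Modulo p², t(m g) is m plus a linear form in the aᵢ (`sq_dvd_multiple_sub`). Up to sign, the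
coefficients of a₁, a₂, a₃, a₄, a₆ are m(m-1)/2, m(m²-1)/3, m(m³-1)/2, 2m(m⁴-1)/5, 3m(m⁶-1)/7. For m
= p each is divisible by p unless p is its denominator, so t(p g) ≡ p except for p = 2, 3, 5, 7,
where the surviving terms give the four exceptional congruences. -/

namespace AdditiveReduction

/-! ### Additive coordinates and their logarithm. -/

section AdditiveFormalGroup

variable {p : ℕ} [Fact p.Prime]

theorem pow_dvd_iff_norm_le (x : ℤ_[p]) (n : ℕ) :
    (p : ℤ_[p]) ^ n ∣ x ↔ ‖x‖ ≤ (p : ℝ) ^ (-n : ℤ) := by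
  rw [PadicInt.norm_le_pow_iff_mem_span_pow, Ideal.mem_span_singleton]

theorem padicInt_cast_ne_zero : (p : ℤ_[p]) ≠ 0 := by
  exact_mod_cast (Fact.out : p.Prime).ne_zero

theorem eq_zero_of_forall_pow_dvd {x : ℤ_[p]} (h : ∀ n : ℕ, (p : ℤ_[p]) ^ n ∣ x) : x = 0 := by
  by_contra hx
  have := PadicInt.prime_p (p := p)
  exact (FiniteMultiplicity.of_not_isUnit this.not_isUnit hx).not_pow_dvd_of_multiplicity_lt
    (Nat.lt_succ_self _) (h _)

theorem isUnit_or_dvd (x : ℤ_[p]) : IsUnit x ∨ (p : ℤ_[p]) ∣ x := by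
  by_cases h : IsUnit x
  · exact Or.inl h
  · right
    rwa [← mem_nonunits_iff, ← IsLocalRing.mem_maximalIdeal, PadicInt.maximalIdeal_eq_span_p,
      Ideal.mem_span_singleton] at h

theorem not_isUnit_of_dvd {x : ℤ_[p]} (h : (p : ℤ_[p]) ∣ x) : ¬ IsUnit x :=
  fun hx => PadicInt.prime_p.not_isUnit (isUnit_of_dvd_unit h hx)

/-- A sequence whose consecutive differences are divisible by growing powers of `p` converges. -/
theorem exists_limit {a : ℕ → ℤ_[p]} (h : ∀ k, (p : ℤ_[p]) ^ k ∣ a (k + 1) - a k) :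
    ∃ L, ∀ k, (p : ℤ_[p]) ^ k ∣ L - a k := by
  have key : ∀ k j, (p : ℤ_[p]) ^ k ∣ a (k + j) - a k := by
    intro k j
    induction j with
    | zero => simp
    | succ j ih =>
      have := dvd_add ((pow_dvd_pow _ (Nat.le_add_right k j)).trans (h (k + j))) ih
      simpa [← add_assoc] using this
  obtain ⟨L, hL⟩ := IsPrecomplete.prec
    (inferInstance : IsPrecomplete (IsLocalRing.maximalIdeal ℤ_[p]) ℤ_[p]) (f := a) (by
      intro m n hmn
      obtain ⟨j, rfl⟩ := Nat.exists_eq_add_of_le hmn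
      rw [SModEq.sub_mem, PadicInt.maximalIdeal_eq_span_p, Ideal.span_singleton_pow,
        smul_eq_mul, Ideal.mul_top, Ideal.mem_span_singleton, ← dvd_neg, neg_sub]
      exact key m j)
  refine ⟨L, fun k => ?_⟩
  have := hL k
  rw [SModEq.sub_mem, PadicInt.maximalIdeal_eq_span_p, Ideal.span_singleton_pow,
    smul_eq_mul, Ideal.mul_top, Ideal.mem_span_singleton, ← dvd_neg, neg_sub] at this
  exact this

/-- Density of the natural numbers makes a closed subgroup a `ℤ_[p]`-submodule. This yields
surjectivity of the logarithm from a single value. -/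
theorem mul_mem_of_isClosed {H : AddSubgroup ℤ_[p]} (hH : IsClosed (H : Set ℤ_[p])) {c : ℤ_[p]}
    (hc : c ∈ H) (z : ℤ_[p]) : c * z ∈ H := by
  refine (PadicInt.denseRange_natCast (p := p)).induction_on (p := fun z => c * z ∈ H) z
    (hH.preimage (continuous_const_mul c)) fun m => ?_
  rw [mul_comm, ← nsmul_eq_mul]
  exact H.nsmul_mem hc m

variable {G : Type*} [AddCommGroup G]

/-- The coordinate `t` on the group `G` makes addition agree with addition of coordinates, to the
precision with which a formal group law with coefficients in `p ℤ_[p]` does. -/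
def IsAdditiveCoordinate (t : G → ℤ_[p]) : Prop :=
  ∀ (n : ℕ) (P Q : G), (p : ℤ_[p]) ^ n ∣ t P → (p : ℤ_[p]) ^ n ∣ t Q →
    (p : ℤ_[p]) ^ (2 * n + 1) ∣ t (P + Q) - (t P + t Q)

namespace IsAdditiveCoordinate

variable {t : G → ℤ_[p]} (ht : IsAdditiveCoordinate t)

include ht

theorem apply_zero : t 0 = 0 := by
  refine eq_zero_of_forall_pow_dvd fun n => ?_
  induction n with
  | zero => simp
  | succ n ih =>
    have := ht n 0 0 ih ih
    rw [add_zero, sub_add_cancel_left, dvd_neg] at this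
    exact (pow_dvd_pow _ (by omega)).trans this

theorem pow_dvd_add {n : ℕ} {P Q : G} (hP : (p : ℤ_[p]) ^ n ∣ t P) (hQ : (p : ℤ_[p]) ^ n ∣ t Q) :
    (p : ℤ_[p]) ^ n ∣ t (P + Q) := by
  have := (pow_dvd_pow _ (by omega : n ≤ 2 * n + 1)).trans (ht n P Q hP hQ)
  simpa using dvd_add this (dvd_add hP hQ)

theorem nsmul {n : ℕ} {P : G} (hP : (p : ℤ_[p]) ^ n ∣ t P) (m : ℕ) :
    (p : ℤ_[p]) ^ n ∣ t (m • P) ∧ (p : ℤ_[p]) ^ (2 * n + 1) ∣ t (m • P) - m * t P := by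
  induction m with
  | zero => simp [ht.apply_zero]
  | succ m ih =>
    rw [succ_nsmul]
    refine ⟨ht.pow_dvd_add ih.1 hP, ?_⟩
    have := dvd_add (ht n _ _ ih.1 hP) ih.2
    refine this.trans (dvd_of_eq ?_)
    push_cast
    ring

theorem pow_smul {n : ℕ} {P : G} (hP : (p : ℤ_[p]) ^ n ∣ t P) (k : ℕ) :
    (p : ℤ_[p]) ^ (n + k) ∣ t (p ^ k • P) := by
  induction k with
  | zero => simpa
  | succ k ih =>
    rw [pow_succ', mul_smul]
    have h1 := (ht.nsmul ih p).2
    have h2 : (p : ℤ_[p]) ^ (n + (k + 1)) ∣ p * t (p ^ k • P) := by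
      rw [← add_assoc, pow_succ']
      exact mul_dvd_mul_left _ ih
    simpa using dvd_add ((pow_dvd_pow _ (by omega)).trans h1) h2

theorem exists_log (P : G) : ∃ z : ℤ_[p], (∀ k : ℕ, (p : ℤ_[p]) ^ (2 * k) ∣
    p ^ k * z - t (p ^ k • P)) ∧ ∀ n, (p : ℤ_[p]) ^ n ∣ t P → (p : ℤ_[p]) ^ (2 * n) ∣ z - t P := by
  have hp := padicInt_cast_ne_zero (p := p)
  have hdiv : ∀ k, (p : ℤ_[p]) ^ k ∣ t (p ^ k • P) := fun k => by
    simpa using ht.pow_smul (n := 0) (P := P) (by simp) k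
  choose a ha using hdiv
  -- For R = p^k P, t(p R) - p t(R) is divisible by p^(2(n+k)+1); cancelling p^(k+1) leaves the
  -- exponent 2n + k. The case n = 0 gives convergence for every P.
  have hstep : ∀ n, (p : ℤ_[p]) ^ n ∣ t P → ∀ k, (p : ℤ_[p]) ^ (2 * n + k) ∣ a (k + 1) - a k := by
    intro n hn k
    have h := (ht.nsmul (ht.pow_smul hn k) p).2
    rw [← mul_smul, ← pow_succ', ha, ha] at h
    rw [← mul_dvd_mul_iff_left (pow_ne_zero (k + 1) hp), ← pow_add]
    convert h using 1 <;> ring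
  obtain ⟨L, hL⟩ := exists_limit (a := a) (fun k => by simpa using hstep 0 (by simp) k)
  refine ⟨L, fun k => ?_, fun n hn => ?_⟩
  · rw [ha, ← mul_sub, two_mul, pow_add]
    exact mul_dvd_mul_left _ (hL k)
  · have h0 : t P = a 0 := by simpa using ha 0
    have key : ∀ j, (p : ℤ_[p]) ^ (2 * n) ∣ a j - a 0 := by
      intro j
      induction j with
      | zero => simp
      | succ j ih =>
        simpa using dvd_add ((pow_dvd_pow _ (by omega)).trans (hstep n hn j)) ih
    rw [h0]
    simpa using dvd_add (hL (2 * n)) (key (2 * n))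

/-- The limit of `t (p ^ k • P) / p ^ k`. -/
noncomputable def log (P : G) : ℤ_[p] := (ht.exists_log P).choose

theorem log_spec (P : G) (k : ℕ) : (p : ℤ_[p]) ^ (2 * k) ∣ p ^ k * ht.log P - t (p ^ k • P) :=
  (ht.exists_log P).choose_spec.1 k

theorem log_congr {P : G} {n : ℕ} (h : (p : ℤ_[p]) ^ n ∣ t P) :
    (p : ℤ_[p]) ^ (2 * n) ∣ ht.log P - t P :=
  (ht.exists_log P).choose_spec.2 n h

/-- The additivity defect of t at p^k P and p^k Q is divisible by p^(2k), so dividing by p^k still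
leaves p^k, for every k. -/
theorem log_add (P Q : G) : ht.log (P + Q) = ht.log P + ht.log Q := by
  refine sub_eq_zero.mp (eq_zero_of_forall_pow_dvd fun k => ?_)
  have h1 := ht.log_spec (P + Q) k
  have h2 := dvd_add (ht.log_spec P k) (ht.log_spec Q k)
  have h3 := ht k (p ^ k • P) (p ^ k • Q) (by simpa using ht.pow_smul (n := 0) (P := P) (by simp) k)
    (by simpa using ht.pow_smul (n := 0) (P := Q) (by simp) k)
  have h4 := dvd_add (dvd_sub h1 h2) ((pow_dvd_pow _ (by omega : 2 * k ≤ 2 * k + 1)).trans h3)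
  rw [← mul_dvd_mul_iff_left (pow_ne_zero k (padicInt_cast_ne_zero (p := p))), ← pow_add,
    ← two_mul]
  refine h4.trans (dvd_of_eq ?_)
  rw [smul_add]
  ring

/-- The map `log` as a homomorphism. -/
noncomputable def logHom : G →+ ℤ_[p] := AddMonoidHom.mk' ht.log ht.log_add

@[simp] theorem logHom_apply (P : G) : ht.logHom P = ht.log P := rfl

/-- For t(g) = 1 this criterion separates the two isomorphism types. It holds because p log g ≡ t(p
g) mod p². -/
theorem dvd_log_iff (g : G) : (p : ℤ_[p]) ∣ ht.log g ↔ (p : ℤ_[p]) ^ 2 ∣ t (p • g) := by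
  have h : (p : ℤ_[p]) ^ 2 ∣ p * ht.log g - t (p • g) := by simpa using ht.log_spec g 1
  rw [← dvd_iff_dvd_of_dvd_sub h, sq, mul_dvd_mul_iff_left padicInt_cast_ne_zero]

theorem dvd_log {P : G} (h : (p : ℤ_[p]) ∣ t P) : (p : ℤ_[p]) ∣ ht.log P := by
  have := ht.log_congr (n := 1) (by simpa using h)
  simpa using dvd_add ((dvd_pow_self _ (by norm_num)).trans this) h

theorem log_eq_nsmul_add (P g : G) (m : ℕ) :
    ht.log P = m * ht.log g + ht.log (P - m • g) := by
  simp only [← ht.logHom_apply, map_sub, map_nsmul, nsmul_eq_mul]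
  ring

theorem eq_zero_of_log_eq_zero (hinj : Function.Injective t) {P : G} (hP : (p : ℤ_[p]) ∣ t P)
    (h : ht.log P = 0) : P = 0 := by
  apply hinj
  rw [ht.apply_zero]
  refine eq_zero_of_forall_pow_dvd fun n => ?_
  induction n with
  | zero => simp
  | succ n ih =>
    -- The congruence log P ≡ t(P) mod p^(2n) doubles the exponent, which is no gain at n = 0; there
    -- the hypothesis p ∣ t(P) takes over.
    rcases Nat.eq_zero_or_pos n with rfl | hn
    · simpa using hP
    · have := ht.log_congr ih
      rw [h, zero_sub, dvd_neg] at this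
      exact (pow_dvd_pow _ (by omega)).trans this

/-- log P modulo p^k depends only on t(p^k P) modulo p^(2k). -/
theorem continuous_log [TopologicalSpace G] [ContinuousAdd G] (hc : Continuous t) :
    Continuous ht.log := by
  have hp : (0 : ℝ) < p := by exact_mod_cast (Fact.out : p.Prime).pos
  rw [continuous_iff_continuousAt]
  intro P
  rw [ContinuousAt, Metric.tendsto_nhds]
  intro ε hε
  obtain ⟨k, hk⟩ := PadicInt.exists_pow_neg_lt p hε
  have hcont : Continuous fun Q : G => t (p ^ k • Q) := hc.comp (continuous_nsmul _)
  have := (Metric.tendsto_nhds.mp (hcont.tendsto P)) ((p : ℝ) ^ (-(2 * k : ℕ) : ℤ)) (by positivity)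
  filter_upwards [this] with Q hQ
  rw [dist_eq_norm] at hQ ⊢
  refine lt_of_le_of_lt ?_ hk
  rw [← pow_dvd_iff_norm_le]
  have h1 := (pow_dvd_iff_norm_le _ _).mpr hQ.le
  have h2 := dvd_add (dvd_sub (ht.log_spec Q k) (ht.log_spec P k)) h1
  rw [← mul_dvd_mul_iff_left (pow_ne_zero k (padicInt_cast_ne_zero (p := p))), ← pow_add,
    ← two_mul]
  refine h2.trans (dvd_of_eq ?_)
  ring

/-- The reduction of the coordinate modulo `p`. -/
noncomputable def residueHom : G →+ ZMod p :=
  AddMonoidHom.mk' (fun P => PadicInt.toZMod (t P)) fun P Q => by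
    have h := ht 0 P Q (by simp) (by simp)
    rw [mul_zero, zero_add, pow_one, ← Ideal.mem_span_singleton, ← PadicInt.maximalIdeal_eq_span_p,
      ← PadicInt.ker_toZMod, RingHom.mem_ker] at h
    simpa [sub_eq_zero] using h

theorem residueHom_apply (P : G) : ht.residueHom P = PadicInt.toZMod (t P) := rfl

theorem residueHom_eq_zero_iff (P : G) : ht.residueHom P = 0 ↔ (p : ℤ_[p]) ∣ t P := by
  rw [residueHom_apply, ← RingHom.mem_ker, PadicInt.ker_toZMod, PadicInt.maximalIdeal_eq_span_p,
    Ideal.mem_span_singleton]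

theorem exists_dvd_sub_nsmul {g : G} (hg : t g = 1) (P : G) :
    ∃ m : ℕ, (p : ℤ_[p]) ∣ t (P - m • g) ∧ (m : ZMod p) = ht.residueHom P := by
  have hm : (((ht.residueHom P).val : ℕ) : ZMod p) = ht.residueHom P := ZMod.natCast_zmod_val _
  refine ⟨(ht.residueHom P).val, ?_, hm⟩
  rw [← ht.residueHom_eq_zero_iff, map_sub, map_nsmul, ht.residueHom_apply g, hg, map_one,
    nsmul_one, hm, sub_self]

end IsAdditiveCoordinate

end AdditiveFormalGroup

/-! ### The two isomorphism types of a compact group with an additive coordinate. -/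

section AdditiveFormalGroup

variable {p : ℕ} [Fact p.Prime]

/-- A continuous bijective homomorphism from a compact group to a Hausdorff group is an isomorphism
of topological groups. -/
theorem nonempty_continuousAddEquiv {G H : Type*} [AddCommGroup G] [TopologicalSpace G]
    [CompactSpace G] [AddCommGroup H] [TopologicalSpace H] [T2Space H] (f : G →+ H)
    (hf : Continuous f) (hb : Function.Bijective f) : Nonempty (G ≃ₜ+ H) :=
  ⟨{ AddEquiv.ofBijective f hb with
    continuous_toFun := hf
    continuous_invFun := (Continuous.homeoOfEquivCompactToT2
      (f := (AddEquiv.ofBijective f hb).toEquiv) hf).continuous_invFun }⟩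

namespace IsAdditiveCoordinate

variable {G : Type*} [AddCommGroup G] [TopologicalSpace G] [ContinuousAdd G] [CompactSpace G]
  {t : G → ℤ_[p]} (ht : IsAdditiveCoordinate t)

include ht

theorem isClosed_range_log (hc : Continuous t) :
    IsClosed (ht.logHom.range : Set ℤ_[p]) := by
  rw [AddMonoidHom.coe_range]
  exact (isCompact_range (ht.continuous_log hc)).isClosed

theorem isClosed_map_ker_residueHom (hc : Continuous t) :
    IsClosed (ht.residueHom.ker.map ht.logHom : Set ℤ_[p]) := by
  rw [AddSubgroup.coe_map]
  have : IsClosed (ht.residueHom.ker : Set G) := by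
    have h : (ht.residueHom.ker : Set G) = t ⁻¹' {x | ‖x‖ ≤ (p : ℝ) ^ (-(1 : ℕ) : ℤ)} := by
      ext P
      rw [SetLike.mem_coe, AddMonoidHom.mem_ker, ht.residueHom_eq_zero_iff, Set.mem_preimage,
        Set.mem_ofPred_eq, ← pow_dvd_iff_norm_le, pow_one]
    rw [h]
    exact (isClosed_le continuous_norm continuous_const).preimage hc
  exact (this.isCompact.image (ht.continuous_log hc)).isClosed

/-- Here log g is a unit. Writing P = m g + P' with p ∣ t(P'), log P = 0 forces p ∣ m, so P lies
where log is injective; the image is a closed subgroup containing a unit. -/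
theorem nonempty_equiv_padicInt (hc : Continuous t) (hinj : Function.Injective t) {g : G}
    (hg : t g = 1) (h : ¬ (p : ℤ_[p]) ^ 2 ∣ t (p • g)) : Nonempty (G ≃ₜ+ ℤ_[p]) := by
  have hu : IsUnit (ht.log g) := (isUnit_or_dvd _).resolve_right (mt (ht.dvd_log_iff g).mp h)
  refine nonempty_continuousAddEquiv ht.logHom (ht.continuous_log hc) ⟨?_, fun z => ?_⟩
  · rw [injective_iff_map_eq_zero]
    intro P hP
    refine ht.eq_zero_of_log_eq_zero hinj ?_ hP
    obtain ⟨m, hm, hm'⟩ := ht.exists_dvd_sub_nsmul hg P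
    rw [← ht.residueHom_eq_zero_iff, ← hm']
    have h0 := ht.log_eq_nsmul_add P g m
    rw [← ht.logHom_apply P, hP] at h0
    have h1 : (p : ℤ_[p]) ∣ m * ht.log g := by
      rw [← dvd_neg, eq_neg_of_add_eq_zero_left h0.symm, neg_neg]
      exact ht.dvd_log hm
    rw [hu.dvd_mul_right, ← Ideal.mem_span_singleton, ← PadicInt.maximalIdeal_eq_span_p,
      ← PadicInt.ker_toZMod, RingHom.mem_ker, map_natCast] at h1
    exact h1
  · obtain ⟨u, hu⟩ := hu
    have := mul_mem_of_isClosed (ht.isClosed_range_log hc) (c := ht.log g) ⟨g, rfl⟩ (↑u⁻¹ * z)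
    rwa [← hu, Units.mul_inv_cancel_left] at this

/-- Here p ∣ log g, so log takes values in pℤ_p everywhere, and residue classes have to be recorded
separately by t mod p. -/
theorem nonempty_equiv_prod (hc : Continuous t) (hb : Function.Bijective t) {g : G}
    (hg : t g = 1) (h : (p : ℤ_[p]) ^ 2 ∣ t (p • g)) :
    Nonempty (G ≃ₜ+ (Ideal.span {(p : ℤ_[p])} : Ideal ℤ_[p]) × ZMod p) := by
  rw [← ht.dvd_log_iff] at h
  have hdvd : ∀ P, (p : ℤ_[p]) ∣ ht.log P := by
    intro P
    obtain ⟨m, hm, -⟩ := ht.exists_dvd_sub_nsmul hg P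
    rw [ht.log_eq_nsmul_add P g m]
    exact dvd_add (h.mul_left _) (ht.dvd_log hm)
  let f₁ : G →+ (Ideal.span {(p : ℤ_[p])} : Ideal ℤ_[p]) :=
    AddMonoidHom.mk' (fun P => ⟨ht.log P, Ideal.mem_span_singleton.mpr (hdvd P)⟩)
      fun P Q => Subtype.ext (ht.log_add P Q)
  refine nonempty_continuousAddEquiv (f₁.prod ht.residueHom) ?_ ⟨?_, ?_⟩
  · refine Continuous.prodMk ((ht.continuous_log hc).subtype_mk _) ?_
    have hcr : Continuous (PadicInt.toZMod : ℤ_[p] → ZMod p) := by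
      refine continuous_of_continuousAt_zero (PadicInt.toZMod (p := p)) ?_
      rw [ContinuousAt, map_zero, nhds_discrete (ZMod p), Filter.tendsto_pure]
      filter_upwards [Metric.ball_mem_nhds (0 : ℤ_[p]) one_pos] with x hx
      rw [← RingHom.mem_ker, PadicInt.ker_toZMod, IsLocalRing.mem_maximalIdeal,
        PadicInt.mem_nonunits]
      simpa using hx
    exact hcr.comp hc
  · rw [injective_iff_map_eq_zero]
    intro P hP
    rw [AddMonoidHom.prod_apply, Prod.mk_eq_zero] at hP
    exact ht.eq_zero_of_log_eq_zero hb.1 ((ht.residueHom_eq_zero_iff P).mp hP.2)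
      (congrArg Subtype.val hP.1)
  · rintro ⟨⟨z, hz⟩, r⟩
    rw [Ideal.mem_span_singleton] at hz
    -- From t(R₀) = p follows log R₀ = p · unit, so the closed image of {p ∣ t} contains pℤ_p. A
    -- preimage of (z, r) is then r g + R with log R = z - r log g.
    obtain ⟨R₀, hR₀⟩ := hb.2 (p : ℤ_[p])
    have hR₀p : (p : ℤ_[p]) ∣ t R₀ := by rw [hR₀]
    obtain ⟨c, hc'⟩ := ht.log_congr (n := 1) (by simpa using hR₀p)
    have hu : IsUnit (1 + p * c : ℤ_[p]) := by
      refine (isUnit_or_dvd _).resolve_right fun hd => ?_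
      exact not_isUnit_of_dvd ((dvd_add_left (dvd_mul_right _ c)).mp hd) isUnit_one
    obtain ⟨u, hu⟩ := hu
    have hlog : ht.log R₀ = p * u := by
      rw [hu, ← sub_add_cancel (ht.log R₀) (t R₀), hc', hR₀]
      ring
    have hz' : (p : ℤ_[p]) ∣ z - r.val * ht.log g := dvd_sub hz ((hdvd g).mul_left _)
    obtain ⟨w, hw⟩ := hz'
    have hmem := mul_mem_of_isClosed (ht.isClosed_map_ker_residueHom hc) (c := ht.log R₀)
      ⟨R₀, (ht.residueHom_eq_zero_iff _).mpr hR₀p, rfl⟩ (↑u⁻¹ * w)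
    rw [hlog, mul_assoc, Units.mul_inv_cancel_left, ← hw] at hmem
    obtain ⟨R, hR, hR'⟩ := hmem
    refine ⟨r.val • g + R, Prod.ext (Subtype.ext ?_) ?_⟩
    · change ht.logHom _ = z
      rw [map_add, map_nsmul, hR', nsmul_eq_mul, ht.logHom_apply]
      ring
    · change ht.residueHom _ = r
      rw [map_add, map_nsmul, hR, ht.residueHom_apply g, hg]
      simp

end IsAdditiveCoordinate

end AdditiveFormalGroup

/-! ### Chords and tangents in the chart Y = 1. -/

section Chart

open WeierstrassCurve

variable {R : Type*} [CommRing R] (W : WeierstrassCurve R)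

/-- The Weierstrass equation in the chart `Y = 1` of the projective plane, with `t = X / Y` and
`s = Z / Y`. -/
def ChartEquation (t s : R) : Prop :=
  s + W.a₁ * t * s + W.a₃ * s ^ 2 = t ^ 3 + W.a₂ * t ^ 2 * s + W.a₄ * t * s ^ 2 + W.a₆ * s ^ 3

/-- The numerator of the slope of a chord in the chart `Y = 1`. -/
def chordNum (t₁ t₂ s₂ : R) : R :=
  t₁ ^ 2 + t₁ * t₂ + t₂ ^ 2 + W.a₂ * s₂ * (t₁ + t₂) + W.a₄ * s₂ ^ 2 - W.a₁ * s₂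

/-- The denominator of the slope of a chord in the chart `Y = 1`. -/
def chordDen (t₁ s₁ s₂ : R) : R :=
  1 + W.a₁ * t₁ + W.a₃ * (s₁ + s₂) - W.a₂ * t₁ ^ 2 - W.a₄ * t₁ * (s₁ + s₂) -
    W.a₆ * (s₁ ^ 2 + s₁ * s₂ + s₂ ^ 2)

/-- The cubic coefficient of the restriction of the equation to the line `s = l t + n`. -/
def lineLead (l : R) : R := 1 + W.a₂ * l + W.a₄ * l ^ 2 + W.a₆ * l ^ 3

/-- The quadratic coefficient of the restriction of the equation to the line `s = l t + n`. -/
def lineQuad (l n : R) : R :=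
  W.a₂ * n + 2 * W.a₄ * l * n + 3 * W.a₆ * l ^ 2 * n - W.a₁ * l - W.a₃ * l ^ 2

/-- Negation in the chart `Y = 1` is `(t, s) ↦ (-t / u, -s / u)` with this denominator `u`. -/
def negDen (t s : R) : R := 1 + W.a₁ * t + W.a₃ * s

variable {W}

/-- The difference of the two equations factors. Hence `chordNum / chordDen` is the chord slope, and
at coincident points it is the tangent slope without a separate formula. -/
theorem ChartEquation.sub_mul_chordDen {t₁ s₁ t₂ s₂ : R} (h₁ : ChartEquation W t₁ s₁)
    (h₂ : ChartEquation W t₂ s₂) :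
    (s₁ - s₂) * chordDen W t₁ s₁ s₂ = (t₁ - t₂) * chordNum W t₁ t₂ s₂ := by
  unfold ChartEquation at h₁ h₂
  unfold chordNum chordDen
  linear_combination h₁ - h₂

/-- The relation between two points `(t₁, s₁)`, `(t₂, s₂)` and a third point `(t, s)` of the chart
that says that the third is given by the chord construction. -/
structure IsChordSum (W : WeierstrassCurve R) (t₁ s₁ t₂ s₂ t s : R) (l t₃ : R) : Prop where
  slope : l * chordDen W t₁ s₁ s₂ = chordNum W t₁ t₂ s₂
  third : lineLead W l * (t₁ + t₂ + t₃) = -lineQuad W l (s₁ - l * t₁)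
  neg_t : negDen W t₃ (l * t₃ + (s₁ - l * t₁)) * t = -t₃
  neg_s : negDen W t₃ (l * t₃ + (s₁ - l * t₁)) * s = -(l * t₃ + (s₁ - l * t₁))

variable {K : Type*} [Field K] {V : WeierstrassCurve K}

theorem ChartEquation.t_eq_zero {t : K} (h : ChartEquation V t 0) : t = 0 := by
  have h' : t ^ 3 = 0 := by
    unfold ChartEquation at h
    linear_combination -h
  exact pow_eq_zero_iff (by norm_num) |>.mp h'

theorem ChartEquation.lineLead_mul {t l : K} (h : ChartEquation V t (l * t)) (ht : t ≠ 0) :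
    lineLead V l * t ^ 2 = l * (1 + (V.a₁ + V.a₃ * l) * t) := by
  refine mul_left_cancel₀ ht ?_
  unfold ChartEquation at h
  unfold lineLead
  linear_combination -h

/-- The line s = l t passes through the identity (0, 0), so its third point is the negative of the
given one, and negating it returns t. -/
theorem third_of_line_through_zero {t l t₃ : K} (h : ChartEquation V t (l * t)) (ht : t ≠ 0)
    (hA : lineLead V l ≠ 0)
    (h₃ : lineLead V l * (t + t₃) = V.a₁ * l + V.a₃ * l ^ 2) :
    negDen V t₃ (l * t₃) * t = -t₃ := by
  have h1 := h.lineLead_mul ht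
  have h2 : lineLead V l * (t * t₃) = -l := by linear_combination t * h₃ - h1
  refine mul_left_cancel₀ hA ?_
  unfold negDen
  linear_combination h₃ + (V.a₁ + V.a₃ * l) * h2

theorem equation_of_chartEquation {t s : K} (h : ChartEquation V t s) (hs : s ≠ 0) :
    V.toAffine.Equation (t / s) (1 / s) := by
  rw [Affine.equation_iff]
  unfold ChartEquation at h
  field_simp
  linear_combination h

/-- Vieta's formulas for the intersection of a Weierstrass curve with a line. -/
theorem addX_slope_vieta [DecidableEq K] {x₁ y₁ x₂ y₂ : K} (h₁ : V.toAffine.Equation x₁ y₁)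
    (h₂ : V.toAffine.Equation x₂ y₂) (hxy : ¬(x₁ = x₂ ∧ y₁ = V.toAffine.negY x₂ y₂)) {l n x₃ : K}
    (hl : V.toAffine.slope x₁ x₂ y₁ y₂ = l) (hn : y₁ = l * x₁ + n)
    (hx₃ : V.toAffine.addX x₁ x₂ l = x₃) :
    V.a₂ = l ^ 2 + V.a₁ * l - (x₁ + x₂ + x₃) ∧
    V.a₄ = x₁ * x₂ + x₁ * x₃ + x₂ * x₃ + 2 * l * n + V.a₁ * n + V.a₃ * l ∧
    V.a₆ = n ^ 2 + V.a₃ * n - x₁ * x₂ * x₃ := by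
  have h := Affine.addPolynomial_slope h₁ h₂ hxy
  rw [hl, hx₃, Affine.addPolynomial_eq, neg_inj, Cubic.prod_X_sub_C_eq, Cubic.toPoly_injective,
    Cubic.mk.injEq] at h
  obtain ⟨-, hb, hc, hd⟩ := h
  subst hn
  refine ⟨?_, ?_, ?_⟩
  · linear_combination hb
  · linear_combination hc
  · linear_combination hd

theorem line_snd [DecidableEq K] {x₁ y₁ x₂ y₂ : K} (h₁ : V.toAffine.Equation x₁ y₁)
    (h₂ : V.toAffine.Equation x₂ y₂) (hxy : ¬(x₁ = x₂ ∧ y₁ = V.toAffine.negY x₂ y₂)) :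
    y₂ - y₁ = V.toAffine.slope x₁ x₂ y₁ y₂ * (x₂ - x₁) := by
  by_cases hx : x₁ = x₂
  · have hy : y₁ ≠ V.toAffine.negY x₂ y₂ := fun h => hxy ⟨hx, h⟩
    rw [Affine.Y_eq_of_Y_ne h₁ h₂ hx hy, hx]
    ring
  · rw [Affine.slope_of_X_ne hx]
    have : x₁ - x₂ ≠ 0 := sub_ne_zero.mpr hx
    field_simp
    ring

/-- The slope of a chord in the chart `Y = 1` in terms of the affine line `y = l x + n`. -/
theorem slope_mul_chordDen [DecidableEq K] {t₁ s₁ t₂ s₂ : K} (h₁ : ChartEquation V t₁ s₁)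
    (h₂ : ChartEquation V t₂ s₂) (hs₂ : s₂ ≠ 0)
    (hD : chordDen V t₁ s₁ s₂ ≠ 0)
    (hxy : ¬(t₁ / s₁ = t₂ / s₂ ∧ 1 / s₁ = V.toAffine.negY (t₂ / s₂) (1 / s₂))) {l n : K}
    (hl : V.toAffine.slope (t₁ / s₁) (t₂ / s₂) (1 / s₁) (1 / s₂) = l)
    (hn₁ : l * t₁ + n * s₁ = 1) (hn₂ : l * t₂ + n * s₂ = 1) :
    l * chordDen V t₁ s₁ s₂ = -n * chordNum V t₁ t₂ s₂ := by
  have h := h₁.sub_mul_chordDen h₂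
  by_cases ht : t₁ = t₂
  · subst ht
    have hs : s₁ = s₂ := by
      rw [sub_self, zero_mul] at h
      exact sub_eq_zero.mp ((mul_eq_zero.mp h).resolve_right hD)
    subst hs
    have hy : 1 / s₁ ≠ V.toAffine.negY (t₁ / s₁) (1 / s₁) := fun h => hxy ⟨rfl, h⟩
    rw [Affine.slope_of_Y_ne rfl hy] at hl
    have hy' := sub_ne_zero.mpr hy
    have hl' := (div_eq_iff hy').mp hl
    have hn : n = (1 - l * t₁) / s₁ := by
      field_simp
      linear_combination hn₁
    rw [Affine.negY] at hl'
    have hl2 : 3 * t₁ ^ 2 + 2 * V.a₂ * t₁ * s₁ + V.a₄ * s₁ ^ 2 - V.a₁ * s₁ =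
        l * s₁ * (2 + V.a₁ * t₁ + V.a₃ * s₁) := by
      field_simp at hl'
      linear_combination hl'
    rw [hn]
    unfold ChartEquation at h₁
    unfold chordDen chordNum
    field_simp
    linear_combination hl2 + 3 * l * h₁
  · refine mul_left_cancel₀ (sub_ne_zero.mpr ht) ?_
    linear_combination (-n) * h + chordDen V t₁ s₁ s₂ * (hn₁ - hn₂)

/-- The affine line y = l x + n is s = (-l/n) t + 1/n in the chart. Evaluating Vieta's factorisation
where y = 0 gives `lineLead` · n³ = y₁y₂y₃, so the third point stays in the chart; the remaining
identity is the sum of the roots t = x/y. -/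
theorem third_of_line {x₁ x₂ x₃ l n : K} (hn : n ≠ 0) (hy₁ : l * x₁ + n ≠ 0)
    (hy₂ : l * x₂ + n ≠ 0) (hA : lineLead V (-l / n) ≠ 0)
    (ha₂ : V.a₂ = l ^ 2 + V.a₁ * l - (x₁ + x₂ + x₃))
    (ha₄ : V.a₄ = x₁ * x₂ + x₁ * x₃ + x₂ * x₃ + 2 * l * n + V.a₁ * n + V.a₃ * l)
    (ha₆ : V.a₆ = n ^ 2 + V.a₃ * n - x₁ * x₂ * x₃) :
    l * x₃ + n ≠ 0 ∧
      lineLead V (-l / n) * (x₁ / (l * x₁ + n) + x₂ / (l * x₂ + n) + x₃ / (l * x₃ + n)) =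
        -lineQuad V (-l / n) (1 / n) := by
  have hprod : lineLead V (-l / n) * n ^ 3 = (l * x₁ + n) * (l * x₂ + n) * (l * x₃ + n) := by
    unfold lineLead
    rw [ha₂, ha₄, ha₆]
    field_simp
    ring
  have hy₃ : l * x₃ + n ≠ 0 := by
    intro h
    rw [h, mul_zero] at hprod
    exact (mul_ne_zero hA (pow_ne_zero 3 hn)) hprod
  refine ⟨hy₃, ?_⟩
  have hA' : lineLead V (-l / n) = (l * x₁ + n) * (l * x₂ + n) * (l * x₃ + n) / n ^ 3 := by
    rw [← hprod]
    field_simp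
  rw [hA']
  unfold lineQuad
  rw [ha₂, ha₄, ha₆]
  field_simp
  ring

end Chart

/-! ### The group law on projective points in chart coordinates. -/

section ChartPoint

open WeierstrassCurve

variable {K : Type*} [Field K] {V : WeierstrassCurve K}

/-- The point `P` has coordinates `[t : 1 : s]`. -/
def HasChart (P : V.toProjective.Point) (t s : K) : Prop :=
  P.point = ⟦![t, 1, s]⟧

theorem HasChart.nonsingular {P : V.toProjective.Point} {t s : K} (h : HasChart P t s) :
    V.toProjective.Nonsingular ![t, 1, s] := by
  have := P.nonsingular
  rwa [h] at this

theorem HasChart.eq {P Q : V.toProjective.Point} {t s : K} (hP : HasChart P t s)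
    (hQ : HasChart Q t s) : P = Q :=
  Projective.Point.ext (hP.trans hQ.symm)

theorem chartEquation_iff (t s : K) :
    V.toProjective.Equation ![t, 1, s] ↔ ChartEquation V t s := by
  rw [Projective.equation_iff, ChartEquation]
  simp only [Projective.fin3_def_ext]
  constructor <;> intro h <;> linear_combination h

theorem HasChart.chartEquation {P : V.toProjective.Point} {t s : K} (h : HasChart P t s) :
    ChartEquation V t s :=
  (chartEquation_iff t s).mp h.nonsingular.1

theorem hasChart_zero : HasChart (0 : V.toProjective.Point) 0 0 :=
  Projective.Point.zero_point

theorem HasChart.eq_zero {P : V.toProjective.Point} {t : K} (h : HasChart P t 0) : P = 0 := by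
  obtain rfl := h.chartEquation.t_eq_zero
  exact h.eq hasChart_zero

theorem chart_eq_of_mk_eq {t s t' s' : K}
    (h : (⟦![t, 1, s]⟧ : Projective.PointClass K) = ⟦![t', 1, s']⟧) : t = t' ∧ s = s' := by
  obtain ⟨u, hu⟩ := Quotient.exact h
  have h0 := congrFun hu 0
  have h1 := congrFun hu 1
  have h2 := congrFun hu 2
  simp [Units.smul_def] at h0 h1 h2
  rw [h1] at h0 h2
  simp at h0 h2
  exact ⟨h0.symm, h2.symm⟩

theorem mk_chart {t s : K} (hs : s ≠ 0) :
    (⟦![t / s, 1 / s, 1]⟧ : Projective.PointClass K) = ⟦![t, 1, s]⟧ := by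
  rw [← Projective.smul_eq ![t / s, 1 / s, 1] (Ne.isUnit hs)]
  congr 1
  ext i
  fin_cases i <;> simp <;> field_simp

theorem hasChart_iff_fromAffine {P : V.toProjective.Point} {t s : K} (hs : s ≠ 0) :
    HasChart P t s ↔ ∃ h : V.toAffine.Nonsingular (t / s) (1 / s),
      P = Projective.Point.fromAffine (.some _ _ h) := by
  constructor
  · intro h
    have hns := h.nonsingular
    refine ⟨?_, ?_⟩
    · rw [← Projective.nonsingular_some, ← Projective.nonsingularLift_iff, mk_chart hs]
      exact hns
    · apply Projective.Point.ext
      exact Eq.trans h (mk_chart hs).symm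
  · rintro ⟨h, rfl⟩
    rw [HasChart, Projective.Point.fromAffine_some, ← mk_chart hs]

theorem HasChart.neg {P : V.toProjective.Point} {t s : K} (h : HasChart P t s)
    (hu : negDen V t s ≠ 0) :
    HasChart (-P) (-t / negDen V t s) (-s / negDen V t s) := by
  rw [HasChart, Projective.Point.neg_point, h, Projective.negMap_eq,
    ← Projective.smul_eq ![-t / negDen V t s, 1, -s / negDen V t s]
      (Ne.isUnit (neg_ne_zero.mpr hu))]
  congr 1
  ext i
  fin_cases i
  · simp [Projective.neg]
    field_simp
  · simp [Projective.neg, Projective.negY, negDen]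
    ring
  · simp [Projective.neg]
    field_simp

theorem fromAffine_add [DecidableEq K] (P Q : V.toAffine.Point) :
    (Projective.Point.fromAffine P + Projective.Point.fromAffine Q : V.toProjective.Point) =
      Projective.Point.fromAffine (P + Q) :=
  ((Projective.Point.toAffineAddEquiv V.toProjective).symm.map_add P Q).symm

theorem IsChordSum.eq_of_third {t₁ s₁ t₂ s₂ t s l t₃ t' s' : K}
    (h : IsChordSum V t₁ s₁ t₂ s₂ t s l t₃)
    (hu : negDen V t₃ (l * t₃ + (s₁ - l * t₁)) ≠ 0)
    (ht : negDen V t₃ (l * t₃ + (s₁ - l * t₁)) * t' = -t₃)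
    (hs : negDen V t₃ (l * t₃ + (s₁ - l * t₁)) * s' = -(l * t₃ + (s₁ - l * t₁))) :
    t = t' ∧ s = s' :=
  ⟨mul_left_cancel₀ hu (h.neg_t.trans ht.symm), mul_left_cancel₀ hu (h.neg_s.trans hs.symm)⟩

/-- The chord construction computes the group law, including in all its degenerate cases. -/
theorem HasChart.add {P Q : V.toProjective.Point} {t₁ s₁ t₂ s₂ t s l t₃ : K}
    (hP : HasChart P t₁ s₁) (hQ : HasChart Q t₂ s₂) (hz₁ : t₁ = 0 → s₁ = 0) (hz₂ : t₂ = 0 → s₂ = 0)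
    (hD : chordDen V t₁ s₁ s₂ ≠ 0) (hA : lineLead V l ≠ 0)
    (hu : negDen V t₃ (l * t₃ + (s₁ - l * t₁)) ≠ 0)
    (h : IsChordSum V t₁ s₁ t₂ s₂ t s l t₃) : HasChart (P + Q) t s := by
  classical
  have e₁ := hP.chartEquation
  have e₂ := hQ.chartEquation
  have hsub := e₁.sub_mul_chordDen e₂
  have hline : t₁ ≠ t₂ → s₁ - s₂ = l * (t₁ - t₂) := fun _ => by
    refine mul_right_cancel₀ hD ?_
    rw [hsub, ← h.slope]
    ring
  -- In the chart, s = 0 holds only at the identity [0:1:0], which has no affine coordinates and is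
  -- treated apart.
  by_cases hs₁ : s₁ = 0
  · subst hs₁
    obtain rfl := e₁.t_eq_zero
    rw [hP.eq_zero, zero_add]
    have hthird := h.third
    by_cases ht₂ : t₂ = 0
    · obtain rfl := hz₂ ht₂
      subst ht₂
      have hl : l = 0 := by
        refine (mul_eq_zero.mp (h.slope.trans ?_)).resolve_right hD
        simp [chordNum]
      subst hl
      have ht₃ : t₃ = 0 := by
        have : lineLead V 0 * t₃ = 0 := by simpa [lineQuad] using hthird
        exact (mul_eq_zero.mp this).resolve_left hA
      subst ht₃
      obtain ⟨rfl, rfl⟩ := h.eq_of_third hu (t' := 0) (s' := 0) (by simp) (by simp)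
      exact hQ
    · have hs₂ : s₂ = l * t₂ := by linear_combination -hline (Ne.symm ht₂)
      subst hs₂
      have hneg := third_of_line_through_zero (t₃ := t₃) e₂ ht₂ hA (by
        unfold lineQuad at hthird
        linear_combination hthird)
      have hn : l * t₃ + (0 - l * 0) = l * t₃ := by ring
      obtain ⟨rfl, rfl⟩ := h.eq_of_third hu (t' := t₂) (s' := l * t₂) (by rw [hn, hneg])
        (by rw [hn]; linear_combination l * hneg)
      exact hQ
  by_cases hs₂ : s₂ = 0
  · subst hs₂
    obtain rfl := e₂.t_eq_zero
    rw [hQ.eq_zero, add_zero]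
    have hthird := h.third
    have ht₁ : t₁ ≠ 0 := fun h => hs₁ (hz₁ h)
    have hs₁ : s₁ = l * t₁ := by linear_combination hline ht₁
    subst hs₁
    have hneg := third_of_line_through_zero (t₃ := t₃) e₁ ht₁ hA (by
      unfold lineQuad at hthird
      linear_combination hthird)
    have hn : l * t₃ + (l * t₁ - l * t₁) = l * t₃ := by ring
    obtain ⟨rfl, rfl⟩ := h.eq_of_third hu (t' := t₁) (s' := l * t₁) (by rw [hn, hneg])
      (by rw [hn]; linear_combination l * hneg)
    exact hP
  obtain ⟨n₁, rfl⟩ := (hasChart_iff_fromAffine hs₁).mp hP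
  obtain ⟨n₂, rfl⟩ := (hasChart_iff_fromAffine hs₂).mp hQ
  rw [fromAffine_add]
  have ht₁ : t₁ ≠ 0 := fun h => hs₁ (hz₁ h)
  have ht₂ : t₂ ≠ 0 := fun h => hs₂ (hz₂ h)
  by_cases hxy : t₁ / s₁ = t₂ / s₂ ∧ 1 / s₁ = V.toAffine.negY (t₂ / s₂) (1 / s₂)
  · rw [Affine.Point.add_of_Y_eq hxy.1 hxy.2, Projective.Point.fromAffine_zero]
    -- The points are mutually inverse, so both lie on a line s = m t through the identity. It
    -- remains to see that l = m and that the third point is t₃ = 0.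
    obtain ⟨hx, hy⟩ := hxy
    rw [Affine.negY] at hy
    obtain ⟨m, rfl⟩ : ∃ m, s₁ = m * t₁ := ⟨s₁ / t₁, by field_simp⟩
    have hm : m ≠ 0 := left_ne_zero_of_mul hs₁
    have hs₂m : s₂ = m * t₂ := by
      field_simp at hx
      linear_combination hx
    subst hs₂m
    have hu₂ : t₂ = -t₁ * (1 + (V.a₁ + V.a₃ * m) * t₂) := by
      field_simp at hy
      linear_combination hy
    set u₂ := 1 + (V.a₁ + V.a₃ * m) * t₂ with hu₂'
    have hu₂0 : u₂ ≠ 0 := fun h => ht₂ (by rw [hu₂, h, mul_zero])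
    have E₁ := e₁.lineLead_mul ht₁
    have E₂ := e₂.lineLead_mul ht₂
    rw [← hu₂'] at E₂
    have E₁₂ : lineLead V m * (t₁ * t₂) = -m := by
      refine mul_right_cancel₀ hu₂0 ?_
      linear_combination (lineLead V m * t₂) * hu₂ - E₂
    have hl : l = m := by
      refine mul_right_cancel₀ hD (h.slope.trans ?_)
      have : chordNum V t₁ t₂ (m * t₂) - m * chordDen V t₁ (m * t₁) (m * t₂) =
          lineLead V m * (t₁ ^ 2 + t₁ * t₂ + t₂ ^ 2) - m * (V.a₁ + V.a₃ * m) * (t₁ + t₂) - m := by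
        unfold chordNum chordDen lineLead
        ring
      linear_combination this + E₁ + E₁₂ + E₂ + m * hu₂'
    subst hl
    have ht₃ : t₃ = 0 := by
      have hthird := h.third
      unfold lineQuad at hthird
      have : t₁ * (lineLead V l * t₃) = 0 := by linear_combination t₁ * hthird - E₁ - E₁₂
      exact (mul_eq_zero.mp ((mul_eq_zero.mp this).resolve_left ht₁)).resolve_left hA
    subst ht₃
    obtain ⟨rfl, rfl⟩ := h.eq_of_third hu (t' := 0) (s' := 0) (by simp) (by simp)
    exact hasChart_zero
  · rw [Affine.Point.add_some hxy]
    have q₁ := equation_of_chartEquation e₁ hs₁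
    have q₂ := equation_of_chartEquation e₂ hs₂
    obtain ⟨ℓ, hℓ⟩ : ∃ ℓ, V.toAffine.slope (t₁ / s₁) (t₂ / s₂) (1 / s₁) (1 / s₂) = ℓ := ⟨_, rfl⟩
    obtain ⟨x₃, hx₃⟩ : ∃ x₃, V.toAffine.addX (t₁ / s₁) (t₂ / s₂) ℓ = x₃ := ⟨_, rfl⟩
    obtain ⟨n, hn⟩ : ∃ n, 1 / s₁ = ℓ * (t₁ / s₁) + n := ⟨1 / s₁ - ℓ * (t₁ / s₁), by ring⟩
    obtain ⟨ha₂, ha₄, ha₆⟩ := addX_slope_vieta q₁ q₂ hxy hℓ hn hx₃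
    have hy := line_snd q₁ q₂ hxy
    have hn' : 1 / s₂ = ℓ * (t₂ / s₂) + n := by
      rw [hℓ] at hy
      linear_combination hy + hn
    have hn₁ : ℓ * t₁ + n * s₁ = 1 := by
      field_simp at hn
      linear_combination -hn
    have hn₂ : ℓ * t₂ + n * s₂ = 1 := by
      field_simp at hn'
      linear_combination -hn'
    have hslope := slope_mul_chordDen e₁ e₂ hs₂ hD hxy hℓ hn₁ hn₂
    rw [← h.slope] at hslope
    have hln : ℓ = -n * l := mul_right_cancel₀ hD (by linear_combination hslope)
    -- If n = 0 then ℓ = -n l = 0 as well, contradicting ℓ t₁ + n s₁ = 1.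
    have hn0 : n ≠ 0 := by
      rintro rfl
      rw [neg_zero, zero_mul] at hln
      simp [hln] at hn₁
    have hl : l = -ℓ / n := by
      rw [hln]
      field_simp
    have hnu : s₁ - l * t₁ = 1 / n := by
      rw [hl]
      field_simp
      linear_combination hn₁
    have hA' := hA
    rw [hl] at hA'
    obtain ⟨hy₃, hthird⟩ := third_of_line hn0 (hn ▸ one_div_ne_zero hs₁)
      (hn' ▸ one_div_ne_zero hs₂) hA' ha₂ ha₄ ha₆
    obtain ⟨y₃, hy₃'⟩ : ∃ y₃, y₃ = ℓ * x₃ + n := ⟨_, rfl⟩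
    rw [← hy₃'] at hy₃ hthird
    have ht₃ : t₃ = x₃ / y₃ := by
      have h1 := h.third
      rw [← hn, ← hn', ← hl, ← hnu] at hthird
      rw [div_div_div_cancel_right₀ hs₁, div_div_div_cancel_right₀ hs₂, div_one, div_one] at hthird
      have := mul_left_cancel₀ hA (h1.trans hthird.symm)
      linear_combination this
    have hs₃ : l * t₃ + (s₁ - l * t₁) = 1 / y₃ := by
      rw [hnu, ht₃, hl]
      field_simp
      rw [hy₃']
      ring
    obtain ⟨w, hw'⟩ : ∃ w, w = y₃ + V.a₁ * x₃ + V.a₃ := ⟨_, rfl⟩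
    have hu' : negDen V t₃ (l * t₃ + (s₁ - l * t₁)) = w / y₃ := by
      rw [hs₃, ht₃, negDen, hw']
      field_simp
    have hw : w ≠ 0 := by
      rintro rfl
      rw [hu', zero_div] at hu
      exact hu rfl
    obtain ⟨rfl, rfl⟩ := h.eq_of_third hu (t' := -x₃ / w) (s' := -1 / w)
      (by rw [hu', ht₃]; field_simp) (by rw [hu', hs₃]; field_simp)
    have hs0 : -1 / w ≠ 0 := by simp [hw]
    have hX : V.toAffine.addX (t₁ / s₁) (t₂ / s₂)
        (V.toAffine.slope (t₁ / s₁) (t₂ / s₂) (1 / s₁) (1 / s₂)) = -x₃ / w / (-1 / w) := by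
      rw [hℓ, hx₃]
      field_simp
    have hY : V.toAffine.addY (t₁ / s₁) (t₂ / s₂) (1 / s₁)
        (V.toAffine.slope (t₁ / s₁) (t₂ / s₂) (1 / s₁) (1 / s₂)) = 1 / (-1 / w) := by
      rw [hℓ, Affine.addY, Affine.negAddY, hx₃, Affine.negY, hn, one_div_div, div_neg, div_one,
        hw', hy₃']
      ring
    refine (hasChart_iff_fromAffine hs0).mpr ⟨?_, ?_⟩
    · rw [← hX, ← hY]
      exact Affine.nonsingular_add n₁ n₂ hxy
    · congr 1
      rw [Affine.Point.some.injEq]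
      exact ⟨hX, hY⟩

end ChartPoint

/-! ### Integral points of the chart and the addition law on `ℤ_[p]`. -/

section IntegralChart

open WeierstrassCurve

variable {p : ℕ} [Fact p.Prime]

theorem toZMod_eq_zero_iff (x : ℤ_[p]) : PadicInt.toZMod x = 0 ↔ (p : ℤ_[p]) ∣ x := by
  rw [← RingHom.mem_ker, PadicInt.ker_toZMod, PadicInt.maximalIdeal_eq_span_p,
    Ideal.mem_span_singleton]

theorem dvd_sub_iff_toZMod_eq (x y : ℤ_[p]) :
    (p : ℤ_[p]) ∣ x - y ↔ PadicInt.toZMod x = PadicInt.toZMod y := by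
  rw [← toZMod_eq_zero_iff, map_sub, sub_eq_zero]

theorem isUnit_of_toZMod_eq_one {x : ℤ_[p]} (h : PadicInt.toZMod x = 1) : IsUnit x := by
  refine (isUnit_or_dvd x).resolve_right fun hd => ?_
  rw [← toZMod_eq_zero_iff, h] at hd
  exact one_ne_zero hd

/-- All coefficients of the Weierstrass equation are divisible by `p`. -/
structure CoeffDvd (W : WeierstrassCurve ℤ_[p]) : Prop where
  a₁ : (p : ℤ_[p]) ∣ W.a₁
  a₂ : (p : ℤ_[p]) ∣ W.a₂
  a₃ : (p : ℤ_[p]) ∣ W.a₃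
  a₄ : (p : ℤ_[p]) ∣ W.a₄
  a₆ : (p : ℤ_[p]) ∣ W.a₆

namespace CoeffDvd

variable {W : WeierstrassCurve ℤ_[p]} (hW : CoeffDvd W)

include hW

theorem toZMod_coeff : PadicInt.toZMod W.a₁ = 0 ∧ PadicInt.toZMod W.a₂ = 0 ∧
    PadicInt.toZMod W.a₃ = 0 ∧ PadicInt.toZMod W.a₄ = 0 ∧ PadicInt.toZMod W.a₆ = 0 := by
  simp only [toZMod_eq_zero_iff]
  exact ⟨hW.a₁, hW.a₂, hW.a₃, hW.a₄, hW.a₆⟩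

/-- Modulo p the chord construction takes place on s = t³: all denominators become 1, the slope
becomes t₁² + t₁t₂ + t₂². -/
theorem toZMod_chordDen (t₁ s₁ s₂ : ℤ_[p]) : PadicInt.toZMod (chordDen W t₁ s₁ s₂) = 1 := by
  obtain ⟨h₁, h₂, h₃, h₄, h₆⟩ := hW.toZMod_coeff
  simp [chordDen, h₁, h₂, h₃, h₄, h₆]

theorem toZMod_chordNum (t₁ t₂ s₂ : ℤ_[p]) : PadicInt.toZMod (chordNum W t₁ t₂ s₂) =
    PadicInt.toZMod t₁ ^ 2 + PadicInt.toZMod t₁ * PadicInt.toZMod t₂ +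
      PadicInt.toZMod t₂ ^ 2 := by
  obtain ⟨h₁, h₂, h₃, h₄, h₆⟩ := hW.toZMod_coeff
  simp [chordNum, h₁, h₂, h₄]

theorem toZMod_lineLead (l : ℤ_[p]) : PadicInt.toZMod (lineLead W l) = 1 := by
  obtain ⟨h₁, h₂, h₃, h₄, h₆⟩ := hW.toZMod_coeff
  simp [lineLead, h₂, h₄, h₆]

theorem toZMod_lineQuad (l n : ℤ_[p]) : PadicInt.toZMod (lineQuad W l n) = 0 := by
  obtain ⟨h₁, h₂, h₃, h₄, h₆⟩ := hW.toZMod_coeff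
  simp [lineQuad, h₁, h₂, h₃, h₄, h₆]

theorem toZMod_negDen (t s : ℤ_[p]) : PadicInt.toZMod (negDen W t s) = 1 := by
  obtain ⟨h₁, h₂, h₃, h₄, h₆⟩ := hW.toZMod_coeff
  simp [negDen, h₁, h₃]

theorem isUnit_chordDen (t₁ s₁ s₂ : ℤ_[p]) : IsUnit (chordDen W t₁ s₁ s₂) :=
  isUnit_of_toZMod_eq_one (hW.toZMod_chordDen ..)

theorem isUnit_lineLead (l : ℤ_[p]) : IsUnit (lineLead W l) :=
  isUnit_of_toZMod_eq_one (hW.toZMod_lineLead ..)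

theorem isUnit_negDen (t s : ℤ_[p]) : IsUnit (negDen W t s) :=
  isUnit_of_toZMod_eq_one (hW.toZMod_negDen ..)

theorem toZMod_snd {t s : ℤ_[p]} (h : ChartEquation W t s) :
    PadicInt.toZMod s = PadicInt.toZMod t ^ 3 := by
  obtain ⟨h₁, h₂, h₃, h₄, h₆⟩ := hW.toZMod_coeff
  simpa [h₁, h₂, h₃, h₄, h₆] using congrArg PadicInt.toZMod h

theorem exists_chartEquation (t : ℤ_[p]) : ∃ s, ChartEquation W t s := by
  classical
  obtain ⟨h₁, h₂, h₃, h₄, h₆⟩ := hW.toZMod_coeff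
  let F : Polynomial ℤ_[p] := Polynomial.X + Polynomial.C (W.a₁ * t) * Polynomial.X +
    Polynomial.C W.a₃ * Polynomial.X ^ 2 - Polynomial.C (t ^ 3) -
    Polynomial.C (W.a₂ * t ^ 2) * Polynomial.X - Polynomial.C (W.a₄ * t) * Polynomial.X ^ 2 -
    Polynomial.C W.a₆ * Polynomial.X ^ 3
  have hF : ∀ s, F.aeval s = s + W.a₁ * t * s + W.a₃ * s ^ 2 - t ^ 3 - W.a₂ * t ^ 2 * s -
      W.a₄ * t * s ^ 2 - W.a₆ * s ^ 3 := by
    intro s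
    simp [F]
  have hF' : PadicInt.toZMod (F.derivative.aeval (t ^ 3)) = 1 := by
    simp [F, h₁, h₂, h₃, h₄, h₆, Polynomial.derivative_pow]
  have hn' : ‖F.derivative.aeval (t ^ 3)‖ = 1 :=
    PadicInt.isUnit_iff.mp (isUnit_of_toZMod_eq_one hF')
  have hn : ‖F.aeval (t ^ 3)‖ < 1 := by
    rw [← PadicInt.mem_nonunits, ← IsLocalRing.mem_maximalIdeal, ← PadicInt.ker_toZMod,
      RingHom.mem_ker, hF]
    simp [h₁, h₂, h₃, h₄, h₆]
  -- Modulo p the equation is s = t³, with derivative 1 in s, so t³ is an approximate simple root.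
  obtain ⟨s, hs, -⟩ := hensels_lemma (F := F) (a := t ^ 3) (by rw [hn', one_pow]; exact hn)
  refine ⟨s, ?_⟩
  rw [hF] at hs
  rw [ChartEquation]
  linear_combination hs

/-- The second coordinate of the integral point of the chart `Y = 1` with first coordinate `t`. -/
noncomputable def snd (t : ℤ_[p]) : ℤ_[p] := (hW.exists_chartEquation t).choose

theorem chartEquation_snd (t : ℤ_[p]) : ChartEquation W t (hW.snd t) :=
  (hW.exists_chartEquation t).choose_spec

theorem eq_snd {t s : ℤ_[p]} (h : ChartEquation W t s) : s = hW.snd t := by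
  have := h.sub_mul_chordDen (hW.chartEquation_snd t)
  rw [sub_self, zero_mul, (hW.isUnit_chordDen ..).mul_left_eq_zero] at this
  exact sub_eq_zero.mp this

theorem snd_zero : hW.snd 0 = 0 :=
  (hW.eq_snd (by simp [ChartEquation])).symm

/-- Chord slopes are integral, so s is 1-Lipschitz in t. -/
theorem continuous_snd : Continuous hW.snd := by
  refine LipschitzWith.continuous (K := 1) (LipschitzWith.of_dist_le_mul fun t₁ t₂ => ?_)
  have h := congrArg norm ((hW.chartEquation_snd t₁).sub_mul_chordDen (hW.chartEquation_snd t₂))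
  rw [norm_mul, norm_mul, PadicInt.isUnit_iff.mp (hW.isUnit_chordDen ..), mul_one] at h
  rw [dist_eq_norm, dist_eq_norm, h, NNReal.coe_one, one_mul]
  exact mul_le_of_le_one_right (norm_nonneg _) (PadicInt.norm_le_one _)

/-- The slope of the chord through two integral points. -/
noncomputable def slope (t₁ t₂ : ℤ_[p]) : ℤ_[p] :=
  chordNum W t₁ t₂ (hW.snd t₂) * Ring.inverse (chordDen W t₁ (hW.snd t₁) (hW.snd t₂))

/-- The intercept of the chord through two integral points. -/
noncomputable def intercept (t₁ t₂ : ℤ_[p]) : ℤ_[p] := hW.snd t₁ - hW.slope t₁ t₂ * t₁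

/-- The first coordinate of the third point on the chord through two integral points. -/
noncomputable def third (t₁ t₂ : ℤ_[p]) : ℤ_[p] :=
  -(t₁ + t₂) - lineQuad W (hW.slope t₁ t₂) (hW.intercept t₁ t₂) *
    Ring.inverse (lineLead W (hW.slope t₁ t₂))

/-- The second coordinate of the third point on the chord through two integral points. -/
noncomputable def thirdSnd (t₁ t₂ : ℤ_[p]) : ℤ_[p] :=
  hW.slope t₁ t₂ * hW.third t₁ t₂ + hW.intercept t₁ t₂

/-- The first coordinate of the sum of two integral points. -/
noncomputable def sum (t₁ t₂ : ℤ_[p]) : ℤ_[p] :=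
  -hW.third t₁ t₂ * Ring.inverse (negDen W (hW.third t₁ t₂) (hW.thirdSnd t₁ t₂))

/-- The second coordinate of the sum of two integral points. -/
noncomputable def sumSnd (t₁ t₂ : ℤ_[p]) : ℤ_[p] :=
  -hW.thirdSnd t₁ t₂ * Ring.inverse (negDen W (hW.third t₁ t₂) (hW.thirdSnd t₁ t₂))

theorem isChordSum (t₁ t₂ : ℤ_[p]) : IsChordSum W t₁ (hW.snd t₁) t₂ (hW.snd t₂)
    (hW.sum t₁ t₂) (hW.sumSnd t₁ t₂) (hW.slope t₁ t₂) (hW.third t₁ t₂) where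
  slope := by
    rw [slope, mul_assoc, Ring.inverse_mul_cancel _ (hW.isUnit_chordDen ..), mul_one]
  third := by
    have h := Ring.inverse_mul_cancel _ (hW.isUnit_lineLead (hW.slope t₁ t₂))
    rw [third, intercept]
    linear_combination (-lineQuad W (hW.slope t₁ t₂) (hW.snd t₁ - hW.slope t₁ t₂ * t₁)) * h
  neg_t := by
    have h := Ring.inverse_mul_cancel _ (hW.isUnit_negDen (hW.third t₁ t₂) (hW.thirdSnd t₁ t₂))
    change negDen W (hW.third t₁ t₂) (hW.thirdSnd t₁ t₂) * _ = _
    rw [sum]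
    linear_combination (-hW.third t₁ t₂) * h
  neg_s := by
    have h := Ring.inverse_mul_cancel _ (hW.isUnit_negDen (hW.third t₁ t₂) (hW.thirdSnd t₁ t₂))
    change negDen W (hW.third t₁ t₂) (hW.thirdSnd t₁ t₂) * _ = -hW.thirdSnd t₁ t₂
    rw [sumSnd]
    linear_combination (-hW.thirdSnd t₁ t₂) * h

theorem continuous_sum : Continuous fun x : ℤ_[p] × ℤ_[p] => hW.sum x.1 x.2 := by
  have hinv : ∀ {f : ℤ_[p] × ℤ_[p] → ℤ_[p]}, Continuous f → (∀ x, IsUnit (f x)) →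
      Continuous fun x => Ring.inverse (f x) := by
    intro f hf hu
    rw [continuous_iff_continuousAt]
    intro x
    obtain ⟨u, hu⟩ := hu x
    refine ContinuousAt.comp (g := Ring.inverse) ?_ hf.continuousAt
    rw [← hu]
    exact NormedRing.inverse_continuousAt u
  have hs := hW.continuous_snd
  have hsl : Continuous fun x : ℤ_[p] × ℤ_[p] => hW.slope x.1 x.2 := by
    refine Continuous.mul ?_ (hinv ?_ fun x => hW.isUnit_chordDen ..)
    · unfold chordNum
      fun_prop
    · unfold chordDen
      fun_prop
  have hint : Continuous fun x : ℤ_[p] × ℤ_[p] => hW.intercept x.1 x.2 := by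
    unfold intercept
    fun_prop
  have hth : Continuous fun x : ℤ_[p] × ℤ_[p] => hW.third x.1 x.2 := by
    refine Continuous.sub (by fun_prop) (Continuous.mul ?_ (hinv ?_ fun x => hW.isUnit_lineLead ..))
    · unfold lineQuad
      fun_prop
    · unfold lineLead
      fun_prop
  refine hth.neg.mul (hinv ?_ fun x => hW.isUnit_negDen ..)
  unfold negDen thirdSnd
  fun_prop

/-- The chart equation has the form s · unit = t³. -/
theorem pow_three_dvd_snd {d t : ℤ_[p]} (h : d ∣ t) : d ^ 3 ∣ hW.snd t := by
  have e : hW.snd t * chordDen W t (hW.snd t) 0 = t ^ 3 := by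
    have := hW.chartEquation_snd t
    unfold ChartEquation at this
    unfold chordDen
    linear_combination this
  rw [← (hW.isUnit_chordDen t (hW.snd t) 0).dvd_mul_right, e]
  exact pow_dvd_pow_of_dvd h 3

/-- When d divides both t's, d³ divides the s's and d² the slope. Every term of `lineQuad`, and the
correction from `negDen`, then carries d² and some aᵢ, hence a factor p. -/
theorem mul_sq_dvd_sum_sub {d t₁ t₂ : ℤ_[p]} (h₁ : d ∣ t₁) (h₂ : d ∣ t₂) :
    p * d ^ 2 ∣ hW.sum t₁ t₂ - (t₁ + t₂) := by
  have H := hW.isChordSum t₁ t₂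
  have d₁ := hW.pow_three_dvd_snd h₁
  have d₂ := hW.pow_three_dvd_snd h₂
  set s₁ := hW.snd t₁
  set s₂ := hW.snd t₂
  set l := hW.slope t₁ t₂
  set t₃ := hW.third t₁ t₂
  set t := hW.sum t₁ t₂
  obtain ⟨x, rfl⟩ := h₁
  obtain ⟨y, rfl⟩ := h₂
  obtain ⟨σ₁, hσ₁⟩ := d₁
  obtain ⟨σ₂, hσ₂⟩ := d₂
  have hl : d ^ 2 ∣ l := by
    rw [← (hW.isUnit_chordDen (d * x) s₁ s₂).dvd_mul_right, H.slope, hσ₂]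
    refine ⟨x ^ 2 + x * y + y ^ 2 + W.a₂ * d ^ 2 * σ₂ * (x + y) + W.a₄ * d ^ 4 * σ₂ ^ 2 -
      W.a₁ * d * σ₂, ?_⟩
    unfold chordNum
    ring
  obtain ⟨m, hm⟩ := hl
  obtain ⟨b₁, hb₁⟩ := hW.a₁
  obtain ⟨b₂, hb₂⟩ := hW.a₂
  obtain ⟨b₃, hb₃⟩ := hW.a₃
  obtain ⟨b₄, hb₄⟩ := hW.a₄
  obtain ⟨b₆, hb₆⟩ := hW.a₆
  have hquad : p * d ^ 2 ∣ d * x + d * y + t₃ := by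
    rw [← (hW.isUnit_lineLead l).dvd_mul_left, H.third, hm, hσ₁]
    unfold lineQuad
    rw [hb₁, hb₂, hb₃, hb₄, hb₆]
    refine ⟨-((b₂ + 2 * b₄ * (d ^ 2 * m) + 3 * b₆ * (d ^ 2 * m) ^ 2) * (d * σ₁ - m * d * x) -
      b₁ * m - b₃ * d ^ 2 * m ^ 2), ?_⟩
    ring
  have ht₃ : d ∣ t₃ := by
    have h := dvd_sub ((Dvd.intro (p * d) (by ring)).trans hquad)
      (Dvd.intro (x + y) (by ring : d * (x + y) = d * x + d * y))
    simpa using h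
  have ht : d ∣ t := by
    rw [← (hW.isUnit_negDen t₃ (l * t₃ + (s₁ - l * (d * x)))).dvd_mul_left, H.neg_t]
    exact ht₃.neg_right
  have hs₃ : d ∣ l * t₃ + (s₁ - l * (d * x)) := by
    refine dvd_add (ht₃.mul_left _) (dvd_sub ?_ ⟨l * x, by ring⟩)
    rw [hσ₁]
    exact ⟨d ^ 2 * σ₁, by ring⟩
  have hneg := H.neg_t
  obtain ⟨z, hz⟩ := ht
  obtain ⟨w, hw⟩ := hs₃
  obtain ⟨v, hv⟩ := ht₃
  obtain ⟨r, hr⟩ := hquad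
  rw [hw, hv, hz, negDen, hb₁, hb₃] at hneg
  rw [hv] at hr
  rw [hz]
  refine ⟨-r - z * (b₁ * v + b₃ * w), ?_⟩
  linear_combination hneg - hr

end CoeffDvd

end IntegralChart

/-! ### Multiples of the point t = 1 modulo p². -/

section Multiples

open WeierstrassCurve Finset

variable {p : ℕ} [Fact p.Prime]

theorem sq_dvd_mul {x y : ℤ_[p]} (hx : (p : ℤ_[p]) ∣ x) (hy : (p : ℤ_[p]) ∣ y) :
    (p : ℤ_[p]) ^ 2 ∣ x * y := by
  rw [sq]
  exact mul_dvd_mul hx hy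

namespace CoeffDvd

variable {W : WeierstrassCurve ℤ_[p]} (hW : CoeffDvd W)

include hW

/-- The group law modulo `p ^ 2`. -/
theorem sq_dvd_sum_sub (x y : ℤ_[p]) :
    (p : ℤ_[p]) ^ 2 ∣ hW.sum x y - (x + y + W.a₁ * (x * y) - W.a₂ * (x * y * (x + y)) +
      W.a₃ * (x * y * (2 * (x + y) ^ 2 - x * y)) -
      W.a₄ * (2 * (x ^ 2 + x * y + y ^ 2) * (x * y * (x + y))) -
      W.a₆ * (3 * (x ^ 2 + x * y + y ^ 2) ^ 2 * (x * y * (x + y)))) := by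
  have H := hW.isChordSum x y
  have r₁ := hW.toZMod_snd (hW.chartEquation_snd x)
  set s₁ := hW.snd x
  set s₂ := hW.snd y
  set l := hW.slope x y
  set t₃ := hW.third x y
  set t := hW.sum x y
  obtain ⟨n, hn⟩ : ∃ n, n = s₁ - l * x := ⟨_, rfl⟩
  obtain ⟨s₃, hs₃⟩ : ∃ s₃, s₃ = l * t₃ + n := ⟨_, rfl⟩
  have hthird := H.third
  have hneg := H.neg_t
  rw [← hn] at hthird hneg
  rw [← hs₃] at hneg
  have rl := congrArg PadicInt.toZMod H.slope
  rw [map_mul, hW.toZMod_chordDen, mul_one, hW.toZMod_chordNum] at rl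
  have rn := congrArg PadicInt.toZMod hn
  rw [map_sub, map_mul, r₁, rl] at rn
  have rt₃ := congrArg PadicInt.toZMod hthird
  rw [map_mul, hW.toZMod_lineLead, one_mul, map_neg, hW.toZMod_lineQuad, neg_zero, map_add, map_add]
    at rt₃
  have rt := congrArg PadicInt.toZMod hneg
  rw [map_mul, hW.toZMod_negDen, one_mul, map_neg] at rt
  have rs₃ := congrArg PadicInt.toZMod hs₃
  rw [map_add, map_mul, rn, rl] at rs₃
  set X := PadicInt.toZMod x
  set Y := PadicInt.toZMod y
  have rt₃' : PadicInt.toZMod t₃ = -(X + Y) := by linear_combination rt₃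
  rw [rt₃'] at rt rs₃
  -- Each aᵢ is divisible by p, so its multiplier matters only modulo p and may be computed on s =
  -- t³, where l = x² + xy + y², n = -xy(x+y), t₃ = -(x+y) and t = x+y.
  have c₀ : (p : ℤ_[p]) ^ 2 ∣ (lineLead W l - 1) * (x + y + t₃) := by
    refine sq_dvd_mul ?_ ?_
    · rw [dvd_sub_iff_toZMod_eq, hW.toZMod_lineLead, map_one]
    · rw [← toZMod_eq_zero_iff, map_add, map_add, rt₃]
  have c₁ : (p : ℤ_[p]) ^ 2 ∣ W.a₁ * ((-l - t * t₃) - x * y) := by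
    refine sq_dvd_mul hW.a₁ ?_
    rw [dvd_sub_iff_toZMod_eq]
    simp only [map_sub, map_neg, map_mul, rl, rt, rt₃']
    ring
  have c₂ : (p : ℤ_[p]) ^ 2 ∣ W.a₂ * (n + x * y * (x + y)) := by
    refine sq_dvd_mul hW.a₂ ?_
    rw [← toZMod_eq_zero_iff]
    simp only [map_add, map_mul, rn]
    ring
  have c₃ : (p : ℤ_[p]) ^ 2 ∣
      W.a₃ * ((-l ^ 2 - t * s₃) - x * y * (2 * (x + y) ^ 2 - x * y)) := by
    refine sq_dvd_mul hW.a₃ ?_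
    rw [dvd_sub_iff_toZMod_eq]
    simp only [map_sub, map_add, map_neg, map_mul, map_pow, map_ofNat, rl, rt, rs₃]
    ring
  have c₄ : (p : ℤ_[p]) ^ 2 ∣
      W.a₄ * (2 * l * n + 2 * (x ^ 2 + x * y + y ^ 2) * (x * y * (x + y))) := by
    refine sq_dvd_mul hW.a₄ ?_
    rw [← toZMod_eq_zero_iff]
    simp only [map_add, map_mul, map_pow, map_ofNat, rl, rn]
    ring
  have c₆ : (p : ℤ_[p]) ^ 2 ∣
      W.a₆ * (3 * l ^ 2 * n + 3 * (x ^ 2 + x * y + y ^ 2) ^ 2 * (x * y * (x + y))) := by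
    refine sq_dvd_mul hW.a₆ ?_
    rw [← toZMod_eq_zero_iff]
    simp only [map_add, map_mul, map_pow, map_ofNat, rl, rn]
    ring
  refine (dvd_add (dvd_add (dvd_add c₀ c₁) (dvd_add c₂ c₃)) (dvd_add c₄ c₆)).trans (dvd_of_eq ?_)
  unfold negDen at hneg
  unfold lineQuad at hthird
  linear_combination hthird - hneg

end CoeffDvd

/-- The coefficients of `a₁`, `-a₂`, `a₃`, `-a₄`, `-a₆` in the first coordinate, modulo `p ^ 2`, of
the sum of the points with first coordinates `x` and `1`. -/
def stepCoeff (x : ℤ) : Fin 5 → ℤ :=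
  ![x, x * (x + 1), x * (2 * (x + 1) ^ 2 - x), 2 * (x ^ 2 + x + 1) * (x * (x + 1)),
    3 * (x ^ 2 + x + 1) ^ 2 * (x * (x + 1))]

/-- The coefficients of `a₁`, `-a₂`, `a₃`, `-a₄`, `-a₆` in the first coordinate, modulo `p ^ 2`, of
the `m`-th multiple of the point with first coordinate `1`. -/
def multipleCoeff (m : ℕ) (i : Fin 5) : ℤ := ∑ k ∈ range m, stepCoeff k i

theorem multipleCoeff_succ (m : ℕ) (i : Fin 5) :
    multipleCoeff (m + 1) i = multipleCoeff m i + stepCoeff m i :=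
  sum_range_succ _ _

/-- The left-hand constants 2, 3, 2, 5, 7 are the source of the exceptional primes. -/
theorem multipleCoeff_formula (m : ℕ) :
    2 * multipleCoeff m 0 = m * (m - 1) ∧ 3 * multipleCoeff m 1 = m * (m ^ 2 - 1) ∧
    2 * multipleCoeff m 2 = m * (m ^ 3 - 1) ∧ 5 * multipleCoeff m 3 = m * (2 * (m ^ 4 - 1)) ∧
    7 * multipleCoeff m 4 = m * (3 * (m ^ 6 - 1)) := by
  induction m with
  | zero => simp [multipleCoeff]
  | succ m ih =>
    obtain ⟨h0, h1, h2, h3, h4⟩ := ih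
    simp only [multipleCoeff_succ, stepCoeff]
    push_cast
    refine ⟨?_, ?_, ?_, ?_, ?_⟩
    · linear_combination h0
    · linear_combination h1
    · linear_combination h2
    · linear_combination h3
    · linear_combination h4

/-- The first coordinate, modulo `p ^ 2`, of the `m`-th multiple of the point with first
coordinate `1`. -/
noncomputable def multipleApprox (W : WeierstrassCurve ℤ_[p]) (m : ℕ) : ℤ_[p] :=
  m + W.a₁ * multipleCoeff m 0 - W.a₂ * multipleCoeff m 1 + W.a₃ * multipleCoeff m 2 -
    W.a₄ * multipleCoeff m 3 - W.a₆ * multipleCoeff m 4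

theorem CoeffDvd.sq_dvd_multiple_sub {W : WeierstrassCurve ℤ_[p]} (hW : CoeffDvd W) {τ : ℕ → ℤ_[p]}
    (h0 : τ 0 = 0) (hsucc : ∀ m, τ (m + 1) = hW.sum (τ m) 1) (m : ℕ) :
    (p : ℤ_[p]) ^ 2 ∣ τ m - multipleApprox W m := by
  induction m with
  | zero => simp [h0, multipleApprox, multipleCoeff]
  | succ m ih =>
    have h := hW.sq_dvd_sum_sub (τ m) 1
    rw [← hsucc] at h
    set x := τ m
    have rx : PadicInt.toZMod x = (m : ZMod p) := by
      have h1 := (dvd_pow_self (p : ℤ_[p]) two_ne_zero).trans ih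
      obtain ⟨h₁, h₂, h₃, h₄, h₆⟩ := hW.toZMod_coeff
      rw [dvd_sub_iff_toZMod_eq] at h1
      simpa [multipleApprox, h₁, h₂, h₃, h₄, h₆] using h1
    have c₁ : (p : ℤ_[p]) ^ 2 ∣ W.a₁ * (x * 1 - (stepCoeff m 0 : ℤ)) := by
      refine sq_dvd_mul hW.a₁ ?_
      rw [dvd_sub_iff_toZMod_eq]
      simp [stepCoeff, rx]
    have c₂ : (p : ℤ_[p]) ^ 2 ∣ W.a₂ * (x * 1 * (x + 1) - (stepCoeff m 1 : ℤ)) := by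
      refine sq_dvd_mul hW.a₂ ?_
      rw [dvd_sub_iff_toZMod_eq]
      simp [stepCoeff, rx]
    have c₃ : (p : ℤ_[p]) ^ 2 ∣
        W.a₃ * (x * 1 * (2 * (x + 1) ^ 2 - x * 1) - (stepCoeff m 2 : ℤ)) := by
      refine sq_dvd_mul hW.a₃ ?_
      rw [dvd_sub_iff_toZMod_eq]
      simp [stepCoeff, rx]
    have c₄ : (p : ℤ_[p]) ^ 2 ∣ W.a₄ * (2 * (x ^ 2 + x * 1 + 1 ^ 2) * (x * 1 * (x + 1)) -
        (stepCoeff m 3 : ℤ)) := by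
      refine sq_dvd_mul hW.a₄ ?_
      rw [dvd_sub_iff_toZMod_eq]
      simp [stepCoeff, rx]
    have c₆ : (p : ℤ_[p]) ^ 2 ∣ W.a₆ * (3 * (x ^ 2 + x * 1 + 1 ^ 2) ^ 2 * (x * 1 * (x + 1)) -
        (stepCoeff m 4 : ℤ)) := by
      refine sq_dvd_mul hW.a₆ ?_
      rw [dvd_sub_iff_toZMod_eq]
      simp [stepCoeff, rx]
    refine (dvd_sub (dvd_add (dvd_add h ih) (dvd_add (dvd_sub c₁ c₂) c₃))
      (dvd_add c₄ c₆)).trans (dvd_of_eq ?_)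
    simp only [multipleApprox, multipleCoeff_succ]
    push_cast
    ring

theorem dvd_multipleCoeff {c d : ℤ} {q : ℕ} (hp : ¬ (p : ℤ) ∣ c) {i : Fin 5}
    (h : c * multipleCoeff q i = p * d) : (p : ℤ_[p]) ∣ (multipleCoeff q i : ℤ) := by
  have hprime : Prime (p : ℤ) := Nat.prime_iff_prime_int.mp Fact.out
  have h1 : (p : ℤ) ∣ multipleCoeff q i :=
    (hprime.dvd_or_dvd ⟨d, h⟩).resolve_left hp
  have h2 := map_dvd (Int.castRingHom ℤ_[p]) h1
  simpa using h2

theorem not_int_dvd {c : ℕ} (hc : c.Prime) (h : p ≠ c) : ¬ (p : ℤ) ∣ (c : ℤ) := by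
  rw [Int.natCast_dvd_natCast, Nat.prime_dvd_prime_iff_eq Fact.out hc]
  exact h

theorem CoeffDvd.sq_dvd_multipleApprox_iff {W : WeierstrassCurve ℤ_[p]} (hW : CoeffDvd W) :
    (p : ℤ_[p]) ^ 2 ∣ multipleApprox W p ↔ IsExceptional W := by
  have hp0 : (p : ℤ_[p]) ≠ 0 := padicInt_cast_ne_zero
  obtain ⟨h0, h1, h2, h3, h4⟩ := multipleCoeff_formula p
  unfold IsExceptional
  have key : ∀ x y : ℤ_[p], (p : ℤ_[p]) ^ 2 ∣ x - y → ((p : ℤ_[p]) ^ 2 ∣ x ↔ (p : ℤ_[p]) ^ 2 ∣ y) :=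
    fun x y h => dvd_iff_dvd_of_dvd_sub h
  have d0 : p ≠ 2 → (p : ℤ_[p]) ^ 2 ∣ W.a₁ * multipleCoeff p 0 := fun h =>
    sq_dvd_mul hW.a₁ (dvd_multipleCoeff (not_int_dvd Nat.prime_two h) h0)
  have d1 : p ≠ 3 → (p : ℤ_[p]) ^ 2 ∣ W.a₂ * multipleCoeff p 1 := fun h =>
    sq_dvd_mul hW.a₂ (dvd_multipleCoeff (not_int_dvd Nat.prime_three h) h1)
  have d2 : p ≠ 2 → (p : ℤ_[p]) ^ 2 ∣ W.a₃ * multipleCoeff p 2 := fun h =>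
    sq_dvd_mul hW.a₃ (dvd_multipleCoeff (not_int_dvd Nat.prime_two h) h2)
  have d3 : p ≠ 5 → (p : ℤ_[p]) ^ 2 ∣ W.a₄ * multipleCoeff p 3 := fun h =>
    sq_dvd_mul hW.a₄ (dvd_multipleCoeff (not_int_dvd Nat.prime_five h) h3)
  have d4 : p ≠ 7 → (p : ℤ_[p]) ^ 2 ∣ W.a₆ * multipleCoeff p 4 := fun h =>
    sq_dvd_mul hW.a₆ (dvd_multipleCoeff (not_int_dvd (by norm_num) h) h4)
  by_cases p2 : p = 2
  · subst p2
    -- As a₃ is even, 2 + a₁ + 7a₃ ≡ a₁ + a₃ - 2 mod 4.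
    have e0 : multipleCoeff 2 0 = 1 := by push_cast at h0; linarith
    have e2 : multipleCoeff 2 2 = 7 := by push_cast at h2; linarith
    obtain ⟨b, hb⟩ := hW.a₃
    rw [key _ (W.a₁ + W.a₃ - 2)]
    · norm_num
    · refine (dvd_sub (dvd_neg.mpr (d1 (by norm_num))) (dvd_add (d3 (by norm_num))
        ((d4 (by norm_num)).add (Dvd.intro (-1 - 3 * b) rfl)))).trans (dvd_of_eq ?_)
      rw [multipleApprox, e0, e2, hb]
      push_cast
      ring
  by_cases p3 : p = 3
  · subst p3
    -- 3 - 8a₂ ≡ a₂ - 6 mod 9.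
    have e1 : multipleCoeff 3 1 = 8 := by push_cast at h1; linarith
    rw [key _ (W.a₂ - 6)]
    · norm_num
    · refine (dvd_sub (dvd_add (d0 (by norm_num)) (d2 (by norm_num))) (dvd_add (d3 (by norm_num))
        ((d4 (by norm_num)).add (Dvd.intro (W.a₂ - 1) rfl)))).trans (dvd_of_eq ?_)
      rw [multipleApprox, e1]
      push_cast
      ring
  by_cases p5 : p = 5
  · subst p5
    -- 1248 = 50 · 25 - 2, so 5 - 1248a₄ ≡ 2(a₄ - 10) mod 25.
    have e3 : multipleCoeff 5 3 = 1248 := by push_cast at h3; linarith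
    have e : (5 : ℤ_[5]) ^ 2 ∣ 2 * (W.a₄ - 10) ↔ (5 : ℤ_[5]) ^ 2 ∣ W.a₄ - 10 := by
      constructor
      · intro h
        exact (dvd_sub (Dvd.intro (W.a₄ - 10) rfl) (h.mul_left 12)).trans (dvd_of_eq (by ring))
      · exact fun h => h.mul_left 2
    rw [key _ (2 * (W.a₄ - 10))]
    · norm_num at e ⊢
      exact e
    · refine (dvd_sub (dvd_add (d0 (by norm_num)) (d2 (by norm_num))) (dvd_add (d1 (by norm_num))
        ((d4 (by norm_num)).add (Dvd.intro (50 * W.a₄ - 1) rfl)))).trans (dvd_of_eq ?_)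
      rw [multipleApprox, e3]
      push_cast
      ring
  by_cases p7 : p = 7
  · subst p7
    -- 352944 = 7203 · 49 - 3, so 7 - 352944a₆ ≡ 3(a₆ - 14) mod 49.
    have e4 : multipleCoeff 7 4 = 352944 := by push_cast at h4; linarith
    have e : (7 : ℤ_[7]) ^ 2 ∣ 3 * (W.a₆ - 14) ↔ (7 : ℤ_[7]) ^ 2 ∣ W.a₆ - 14 := by
      constructor
      · intro h
        exact (dvd_sub (Dvd.intro (W.a₆ - 14) rfl) (h.mul_left 16)).trans (dvd_of_eq (by ring))
      · exact fun h => h.mul_left 3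
    rw [key _ (3 * (W.a₆ - 14))]
    · norm_num at e ⊢
      exact e
    · refine (dvd_sub (dvd_add (d0 (by norm_num)) (d2 (by norm_num))) (dvd_add (d1 (by norm_num))
        ((d3 (by norm_num)).add (Dvd.intro (7203 * W.a₆ - 1) rfl)))).trans (dvd_of_eq ?_)
      rw [multipleApprox, e4]
      push_cast
      ring
  simp only [p2, p3, p5, p7, false_and, or_false, iff_false]
  rw [key _ (p : ℤ_[p])]
  · intro h
    rw [sq] at h
    exact not_isUnit_of_dvd ((mul_dvd_mul_iff_left hp0).mp (by simpa using h)) isUnit_one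
  · refine (dvd_sub (dvd_add (d0 p2) (d2 p2)) (dvd_add (d1 p3)
      ((d3 p5).add (d4 p7)))).trans (dvd_of_eq ?_)
    rw [multipleApprox]
    ring

end Multiples

/-! ### Topology of the chart, and E₀ as a topological group. -/

section Topology

open WeierstrassCurve Topology

section Chart

variable {K : Type*} [Field K] {V : WeierstrassCurve K}

/-- `chordDen V t s s` is the partial derivative of the chart equation in s, so the argument works
in every characteristic. -/
theorem nonsingular_of_chordDen_ne_zero {t s : K} (h : ChartEquation V t s)
    (hD : chordDen V t s s ≠ 0) : V.toProjective.Nonsingular ![t, 1, s] := by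
  rw [Projective.nonsingular_iff]
  refine ⟨(chartEquation_iff t s).mpr h, Or.inr (Or.inr ?_)⟩
  simp only [Projective.fin3_def_ext]
  convert hD using 1
  unfold chordDen
  ring

variable [TopologicalSpace K]

theorem continuous_of_hasChart {X : Type*} [TopologicalSpace X] {P : X → V.toProjective.Point}
    {t s : X → K} (ht : Continuous t) (hs : Continuous s) (hP : ∀ x, HasChart (P x) (t x) (s x)) :
    Continuous P := by
  have hne : ∀ x, ![t x, 1, s x] ≠ 0 := fun x h => one_ne_zero (congrFun h 1)
  let T : TopologicalSpace (Projective.PointClass K) := TopologicalSpace.coinduced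
    (fun v : {v : Fin 3 → K // v ≠ 0} => (Quotient.mk _ v.1 : Projective.PointClass K))
    inferInstance
  refine (continuous_induced_rng (t₂ := T)).mpr ?_
  have h : (fun P : V.toProjective.Point => P.point) ∘ P =
      (fun v : {v : Fin 3 → K // v ≠ 0} => (Quotient.mk _ v.1 : Projective.PointClass K)) ∘
        fun x => ⟨![t x, 1, s x], hne x⟩ := funext hP
  rw [h]
  refine @Continuous.comp _ _ _ _ _ T _ _ continuous_coinduced_rng
    (Continuous.subtype_mk (continuous_pi fun i => ?_) hne)
  fin_cases i
  · exact ht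
  · exact continuous_const
  · exact hs

/-- In the space of nonzero vectors the preimage is given by v₁ ≠ 0 and v₀/v₁ ∈ U, which is open. -/
theorem isOpen_setOf_chart [IsTopologicalDivisionRing K] [T1Space K] {U : Set K} (hU : IsOpen U) :
    IsOpen {P : V.toProjective.Point | ∃ t ∈ U, ∃ s, HasChart P t s} := by
  let S : Set (Projective.PointClass K) := {c | ∃ t ∈ U, ∃ s, c = ⟦![t, 1, s]⟧}
  suffices h : IsOpen[TopologicalSpace.coinduced (fun v : {v : Fin 3 → K // v ≠ 0} =>
      (Quotient.mk _ v.1 : Projective.PointClass K)) inferInstance] S from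
    (isOpen_induced_iff (t := TopologicalSpace.coinduced (fun v : {v : Fin 3 → K // v ≠ 0} =>
      (Quotient.mk _ v.1 : Projective.PointClass K)) inferInstance)).mpr ⟨S, h, rfl⟩
  rw [isOpen_coinduced]
  have hS : (fun v : {v : Fin 3 → K // v ≠ 0} => (Quotient.mk _ v.1 : Projective.PointClass K)) ⁻¹'
      S = {v | v.1 1 ≠ 0} ∩ (fun v => v.1 0 / v.1 1) ⁻¹' U := by
    ext ⟨v, hv⟩
    constructor
    · rintro ⟨t, ht, s, h⟩
      obtain ⟨u, rfl⟩ := Quotient.exact h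
      refine ⟨by simp [Units.smul_def], ?_⟩
      simpa [Units.smul_def] using ht
    · rintro ⟨h1, h0⟩
      have h1 : v 1 ≠ 0 := h1
      refine ⟨v 0 / v 1, h0, v 2 / v 1, ?_⟩
      change (⟦v⟧ : Projective.PointClass K) = _
      rw [← Projective.smul_eq ![v 0 / v 1, 1, v 2 / v 1] (Ne.isUnit h1)]
      congr 1
      ext i
      fin_cases i <;> simp <;> field_simp
  rw [hS]
  have hc : ∀ i, Continuous fun v : {v : Fin 3 → K // v ≠ 0} => v.1 i := fun i =>
    (continuous_apply i).comp continuous_subtype_val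
  refine ContinuousOn.isOpen_inter_preimage ?_ (isOpen_ne.preimage (hc 1)) hU
  exact (hc 0).continuousOn.div (hc 1).continuousOn fun v hv => hv

theorem continuous_fst_of_hasChart [IsTopologicalDivisionRing K] [T1Space K] {X : Type*}
    [TopologicalSpace X] {P : X → V.toProjective.Point} (hc : Continuous P) {t s : X → K}
    (hP : ∀ x, HasChart (P x) (t x) (s x)) : Continuous t := by
  refine continuous_def.mpr fun U hU => ?_
  convert (isOpen_setOf_chart hU).preimage hc using 1
  ext x
  constructor
  · exact fun hx => ⟨t x, hx, s x, hP x⟩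
  · rintro ⟨t', ht', s', h⟩
    have := (chart_eq_of_mk_eq ((hP x).symm.trans h)).1
    rwa [Set.mem_preimage, this]

end Chart

section BaseChange

variable {R S : Type*} [CommRing R] [CommRing S] (W : WeierstrassCurve R) (f : R →+* S)

theorem map_chordNum (t₁ t₂ s₂ : R) :
    chordNum (W.map f) (f t₁) (f t₂) (f s₂) = f (chordNum W t₁ t₂ s₂) := by
  simp [chordNum]

theorem map_chordDen (t₁ s₁ s₂ : R) :
    chordDen (W.map f) (f t₁) (f s₁) (f s₂) = f (chordDen W t₁ s₁ s₂) := by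
  simp [chordDen]

theorem map_lineLead (l : R) : lineLead (W.map f) (f l) = f (lineLead W l) := by
  simp [lineLead]

theorem map_lineQuad (l n : R) : lineQuad (W.map f) (f l) (f n) = f (lineQuad W l n) := by
  simp [lineQuad, map_ofNat]

theorem map_negDen (t s : R) : negDen (W.map f) (f t) (f s) = f (negDen W t s) := by
  simp [negDen]

variable {W}

theorem ChartEquation.map {t s : R} (h : ChartEquation W t s) :
    ChartEquation (W.map f) (f t) (f s) := by
  simpa [ChartEquation] using congrArg f h

theorem ChartEquation.of_map (hf : Function.Injective f) {t s : R}
    (h : ChartEquation (W.map f) (f t) (f s)) : ChartEquation W t s :=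
  hf (by simpa [ChartEquation] using h)

theorem IsChordSum.map {t₁ s₁ t₂ s₂ t s l t₃ : R} (h : IsChordSum W t₁ s₁ t₂ s₂ t s l t₃) :
    IsChordSum (W.map f) (f t₁) (f s₁) (f t₂) (f s₂) (f t) (f s) (f l) (f t₃) where
  slope := by rw [map_chordDen, map_chordNum, ← map_mul, h.slope]
  third := by
    rw [map_lineLead, ← map_mul, ← map_sub, map_lineQuad, ← map_neg, ← h.third]
    simp
  neg_t := by
    simp only [← map_mul, ← map_sub, ← map_add, map_negDen, h.neg_t, ← map_neg]
  neg_s := by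
    simp only [← map_mul, ← map_sub, ← map_add, map_negDen, h.neg_s, ← map_neg]

end BaseChange

theorem continuousAdd_of_homeomorph {G X : Type*} [Add G] [TopologicalSpace G] [TopologicalSpace X]
    (e : G ≃ₜ X) {f : X → X → X} (hf : Continuous fun x : X × X => f x.1 x.2)
    (h : ∀ a b, e (a + b) = f (e a) (e b)) : ContinuousAdd G where
  continuous_add := by
    have h1 : Continuous fun x : G × G => e.symm (f (e x.1) (e x.2)) :=
      e.symm.continuous.comp (hf.comp (e.continuous.prodMap e.continuous))
    refine h1.congr fun x => ?_
    rw [← h, e.symm_apply_apply]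

variable {p : ℕ} [Fact p.Prime]

/-- The rational point `P` has integral coordinates `[t : 1 : s]`. -/
abbrev HasIntegralChart {W : WeierstrassCurve ℤ_[p]} (P : RationalPoint W) (t s : ℤ_[p]) : Prop :=
  HasChart (V := W.baseChange ℚ_[p]) P (algebraMap ℤ_[p] ℚ_[p] t) (algebraMap ℤ_[p] ℚ_[p] s)

theorem algebraMap_ne_zero_of_isUnit {x : ℤ_[p]} (hx : IsUnit x) : algebraMap ℤ_[p] ℚ_[p] x ≠ 0 :=
  (hx.map (algebraMap ℤ_[p] ℚ_[p])).ne_zero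

namespace CoeffDvd

variable {W : WeierstrassCurve ℤ_[p]} (hW : CoeffDvd W)

include hW

theorem snd_eq_of_hasIntegralChart {P : RationalPoint W} {t s : ℤ_[p]}
    (h : HasIntegralChart P t s) : s = hW.snd t :=
  hW.eq_snd (ChartEquation.of_map _ (FaithfulSMul.algebraMap_injective _ _) h.chartEquation)

theorem exists_point (t : ℤ_[p]) :
    ∃ P : RationalPoint W, HasIntegralChart P t (hW.snd t) := by
  have hns := nonsingular_of_chordDen_ne_zero
    ((hW.chartEquation_snd t).map (algebraMap ℤ_[p] ℚ_[p])) (by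
      rw [map_chordDen]
      exact algebraMap_ne_zero_of_isUnit (hW.isUnit_chordDen ..))
  exact ⟨⟨(Projective.nonsingularLift_iff _).mpr hns⟩, rfl⟩

/-- On Y²Z = X³, Y = 0 forces X = 0, the cusp. Nonsingular reduction therefore means that Y is a
unit, and Y can be scaled to 1. -/
theorem mem_nonsingularReduction_iff (P : RationalPoint W) :
    P ∈ nonsingularReduction W ↔ ∃ t, HasIntegralChart P t (hW.snd t) := by
  have res : ∀ {x : ℤ_[p]}, (p : ℤ_[p]) ∣ x → IsLocalRing.residue ℤ_[p] x = 0 := fun h => by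
    rwa [IsLocalRing.residue_eq_zero_iff, PadicInt.maximalIdeal_eq_span_p,
      Ideal.mem_span_singleton]
  have r₁ : (specialFibre W).a₁ = 0 := res hW.a₁
  have r₂ : (specialFibre W).a₂ = 0 := res hW.a₂
  have r₃ : (specialFibre W).a₃ = 0 := res hW.a₃
  have r₄ : (specialFibre W).a₄ = 0 := res hW.a₄
  have r₆ : (specialFibre W).a₆ = 0 := res hW.a₆
  constructor
  · rintro ⟨Q, -, hQ, hns⟩
    rw [Projective.nonsingular_iff, Projective.equation_iff] at hns
    simp only [r₁, r₂, r₃, r₄, r₆, zero_mul, mul_zero, add_zero, sub_zero, zero_sub] at hns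
    have hY : IsUnit (Q 1) := by
      rw [← IsLocalRing.residue_ne_zero_iff_isUnit]
      intro h0
      obtain ⟨heq, hns⟩ := hns
      rw [h0] at heq hns
      have hX : IsLocalRing.residue ℤ_[p] (Q 0) = 0 := by
        have : IsLocalRing.residue ℤ_[p] (Q 0) ^ 3 = 0 := by simpa using heq.symm
        exact pow_eq_zero_iff (by norm_num) |>.mp this
      rw [hX] at hns
      simp at hns
    obtain ⟨u, hu⟩ := hY
    have hP : HasIntegralChart P (↑u⁻¹ * Q 0) (↑u⁻¹ * Q 2) := by
      rw [HasIntegralChart, HasChart, hQ]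
      rw [← Projective.smul_eq ![_, _, _] (Ne.isUnit (algebraMap_ne_zero_of_isUnit u.isUnit))]
      congr 1
      ext i
      fin_cases i
      · simp [← mul_assoc, ← PadicInt.coe_mul]
      · simp [← hu]
      · simp [← mul_assoc, ← PadicInt.coe_mul]
    refine ⟨↑u⁻¹ * Q 0, ?_⟩
    rw [← hW.snd_eq_of_hasIntegralChart hP]
    exact hP
  · rintro ⟨t, ht⟩
    refine ⟨![t, 1, hW.snd t], ⟨1, by simp⟩, ?_, ?_⟩
    · refine Eq.trans ht (congrArg _ ?_)
      ext i
      fin_cases i <;> simp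
    · have h := (hW.chartEquation_snd t).map (IsLocalRing.residue ℤ_[p])
      have := nonsingular_of_chordDen_ne_zero (V := specialFibre W) h (by
        simp [chordDen, r₁, r₂, r₃, r₄, r₆])
      have e : (fun i => IsLocalRing.residue ℤ_[p] (![t, 1, hW.snd t] i)) =
          ![IsLocalRing.residue ℤ_[p] t, 1, IsLocalRing.residue ℤ_[p] (hW.snd t)] := by
        funext i
        fin_cases i <;> simp
      rw [e]
      exact this

theorem hasIntegralChart_add {P Q : RationalPoint W} {t₁ t₂ : ℤ_[p]}
    (hP : HasIntegralChart P t₁ (hW.snd t₁)) (hQ : HasIntegralChart Q t₂ (hW.snd t₂)) :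
    HasIntegralChart (P + Q) (hW.sum t₁ t₂) (hW.snd (hW.sum t₁ t₂)) := by
  have hz : ∀ t, algebraMap ℤ_[p] ℚ_[p] t = 0 → algebraMap ℤ_[p] ℚ_[p] (hW.snd t) = 0 := by
    intro t ht
    rw [FaithfulSMul.algebraMap_eq_zero_iff] at ht
    rw [ht, hW.snd_zero, map_zero]
  have h := HasChart.add hP hQ (hz t₁) (hz t₂)
    (by
      rw [WeierstrassCurve.baseChange, map_chordDen]
      exact algebraMap_ne_zero_of_isUnit (hW.isUnit_chordDen ..))
    (by
      rw [WeierstrassCurve.baseChange, map_lineLead]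
      exact algebraMap_ne_zero_of_isUnit (hW.isUnit_lineLead (hW.slope t₁ t₂)))
    (by
      simp only [← map_mul, ← map_sub, ← map_add]
      rw [WeierstrassCurve.baseChange, map_negDen]
      exact algebraMap_ne_zero_of_isUnit (hW.isUnit_negDen (hW.third t₁ t₂) _))
    ((hW.isChordSum t₁ t₂).map (algebraMap ℤ_[p] ℚ_[p]))
  have h' : HasIntegralChart (P + Q) (hW.sum t₁ t₂) (hW.sumSnd t₁ t₂) := h
  rwa [hW.snd_eq_of_hasIntegralChart h'] at h'

theorem hasIntegralChart_neg {P : RationalPoint W} {t : ℤ_[p]}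
    (hP : HasIntegralChart P t (hW.snd t)) :
    ∃ t', HasIntegralChart (-P) t' (hW.snd t') := by
  obtain ⟨u, hu⟩ := hW.isUnit_negDen t (hW.snd t)
  have hu0 := algebraMap_ne_zero_of_isUnit u.isUnit
  have hmap : negDen (W.baseChange ℚ_[p]) (algebraMap ℤ_[p] ℚ_[p] t)
      (algebraMap ℤ_[p] ℚ_[p] (hW.snd t)) = algebraMap ℤ_[p] ℚ_[p] u := by
    rw [WeierstrassCurve.baseChange, map_negDen, hu]
  have h := HasChart.neg hP (hmap ▸ hu0)
  have hdiv : ∀ x : ℤ_[p], -algebraMap ℤ_[p] ℚ_[p] x / algebraMap ℤ_[p] ℚ_[p] u =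
      algebraMap ℤ_[p] ℚ_[p] (-x * ↑u⁻¹) := fun x => by
    rw [div_eq_iff hu0, ← map_mul, mul_assoc, Units.inv_mul, mul_one, map_neg]
  rw [hmap, hdiv, hdiv] at h
  have h' : HasIntegralChart (-P) (-t * ↑u⁻¹) (-hW.snd t * ↑u⁻¹) := h
  exact ⟨_, by rwa [hW.snd_eq_of_hasIntegralChart h'] at h'⟩

/-- The subgroup of points with nonsingular reduction. -/
def nonsingularSubgroup : AddSubgroup (RationalPoint W) where
  carrier := nonsingularReduction W
  zero_mem' := (hW.mem_nonsingularReduction_iff 0).mpr ⟨0, by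
    rw [hW.snd_zero, HasIntegralChart, map_zero]
    exact hasChart_zero⟩
  add_mem' {P Q} hP hQ := by
    obtain ⟨t₁, h₁⟩ := (hW.mem_nonsingularReduction_iff P).mp hP
    obtain ⟨t₂, h₂⟩ := (hW.mem_nonsingularReduction_iff Q).mp hQ
    exact (hW.mem_nonsingularReduction_iff _).mpr ⟨_, hW.hasIntegralChart_add h₁ h₂⟩
  neg_mem' {P} hP := by
    obtain ⟨t, h⟩ := (hW.mem_nonsingularReduction_iff P).mp hP
    exact (hW.mem_nonsingularReduction_iff _).mpr (hW.hasIntegralChart_neg h)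

/-- The coordinate `X / Y` on the points with nonsingular reduction. -/
noncomputable def coord (P : hW.nonsingularSubgroup) : ℤ_[p] :=
  ((hW.mem_nonsingularReduction_iff P.1).mp P.2).choose

theorem hasIntegralChart_coord (P : hW.nonsingularSubgroup) :
    HasIntegralChart P.1 (hW.coord P) (hW.snd (hW.coord P)) :=
  ((hW.mem_nonsingularReduction_iff P.1).mp P.2).choose_spec

theorem coord_eq {P : hW.nonsingularSubgroup} {t s : ℤ_[p]} (h : HasIntegralChart P.1 t s) :
    hW.coord P = t :=
  FaithfulSMul.algebraMap_injective ℤ_[p] ℚ_[p]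
    (chart_eq_of_mk_eq ((hW.hasIntegralChart_coord P).symm.trans h)).1

theorem coord_add (P Q : hW.nonsingularSubgroup) :
    hW.coord (P + Q) = hW.sum (hW.coord P) (hW.coord Q) :=
  hW.coord_eq (hW.hasIntegralChart_add (hW.hasIntegralChart_coord P) (hW.hasIntegralChart_coord Q))

/-- The coordinate `X / Y` is a homeomorphism from the points with nonsingular reduction to the
`p`-adic integers. -/
noncomputable def coordHomeomorph : hW.nonsingularSubgroup ≃ₜ ℤ_[p] where
  toFun := hW.coord
  invFun t := ⟨(hW.exists_point t).choose, (hW.mem_nonsingularReduction_iff _).mpr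
    ⟨t, (hW.exists_point t).choose_spec⟩⟩
  left_inv P := Subtype.ext
    (HasChart.eq (hW.exists_point (hW.coord P)).choose_spec (hW.hasIntegralChart_coord P))
  right_inv t := hW.coord_eq (hW.exists_point t).choose_spec
  continuous_toFun := by
    have h := continuous_fst_of_hasChart (V := W.baseChange ℚ_[p]) continuous_subtype_val
      hW.hasIntegralChart_coord
    exact continuous_induced_rng.mpr h
  continuous_invFun := by
    refine Continuous.subtype_mk (continuous_of_hasChart (V := W.baseChange ℚ_[p])
      continuous_subtype_val (continuous_subtype_val.comp hW.continuous_snd) fun t =>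
      (hW.exists_point t).choose_spec) _

theorem continuousAdd : ContinuousAdd hW.nonsingularSubgroup :=
  continuousAdd_of_homeomorph hW.coordHomeomorph hW.continuous_sum hW.coord_add

theorem isAdditiveCoordinate : IsAdditiveCoordinate hW.coordHomeomorph := by
  intro n P Q hP hQ
  have h := hW.mul_sq_dvd_sum_sub hP hQ
  rw [← pow_mul, mul_comm n 2, ← pow_succ'] at h
  change _ ∣ hW.coord (P + Q) - (hW.coord P + hW.coord Q)
  rw [hW.coord_add]
  exact h

theorem sq_dvd_coord_nsmul_iff {g : hW.nonsingularSubgroup} (hg : hW.coordHomeomorph g = 1) :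
    (p : ℤ_[p]) ^ 2 ∣ hW.coordHomeomorph (p • g) ↔ IsExceptional W := by
  rw [← hW.sq_dvd_multipleApprox_iff]
  -- The coordinates of m g satisfy the recursion of adding the point t = 1, so `multipleApprox`
  -- gives them modulo p².
  refine dvd_iff_dvd_of_dvd_sub (hW.sq_dvd_multiple_sub (τ := fun m => hW.coordHomeomorph (m • g))
    ?_ (fun m => ?_) p)
  · rw [zero_smul]
    exact hW.isAdditiveCoordinate.apply_zero
  · rw [← hg]
    change hW.coord _ = hW.sum (hW.coord _) (hW.coord _)
    rw [succ_nsmul, hW.coord_add]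

end CoeffDvd

end Topology

end AdditiveReduction

theorem theorem1 (p : ℕ) [Fact p.Prime] (W : WeierstrassCurve ℤ_[p])
    (hell : (W.baseChange ℚ_[p]).IsElliptic)
    (hmin : (W.baseChange ℚ_[p]).IsMinimal ℤ_[p])
    (hadd : (W.baseChange ℚ_[p]).HasAdditiveReduction ℤ_[p])
    (h₁ : (p : ℤ_[p]) ∣ W.a₁) (h₂ : (p : ℤ_[p]) ∣ W.a₂) (h₃ : (p : ℤ_[p]) ∣ W.a₃)
    (h₄ : (p : ℤ_[p]) ∣ W.a₄) (h₆ : (p : ℤ_[p]) ∣ W.a₆) :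
    ∃ E₀ : AddSubgroup (AdditiveReduction.RationalPoint W),
      (E₀ : Set (AdditiveReduction.RationalPoint W)) =
        AdditiveReduction.nonsingularReduction W ∧
      (¬ AdditiveReduction.IsExceptional W → Nonempty (E₀ ≃ₜ+ ℤ_[p])) ∧
      (AdditiveReduction.IsExceptional W →
        Nonempty (E₀ ≃ₜ+ (Ideal.span {(p : ℤ_[p])} : Ideal ℤ_[p]) × ZMod p)) := by
  have hW : AdditiveReduction.CoeffDvd W := ⟨h₁, h₂, h₃, h₄, h₆⟩
  have := hW.coordHomeomorph.symm.compactSpace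
  have := hW.continuousAdd
  obtain ⟨g, hg⟩ := hW.coordHomeomorph.surjective 1
  refine ⟨hW.nonsingularSubgroup, rfl, fun h => ?_, fun h => ?_⟩
  · exact hW.isAdditiveCoordinate.nonempty_equiv_padicInt hW.coordHomeomorph.continuous
      hW.coordHomeomorph.injective hg (mt (hW.sq_dvd_coord_nsmul_iff hg).mp h)
  · exact hW.isAdditiveCoordinate.nonempty_equiv_prod hW.coordHomeomorph.continuous
      hW.coordHomeomorph.bijective hg ((hW.sq_dvd_coord_nsmul_iff hg).mpr h)
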